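/- Let $m\ge 1$ be an integer, let $\mu>0$, $\nu>\tfrac12$ with $\mu+\nu>1$, let $\varepsilon\in\mathbb{R}$, $\beta_1,\beta_2>0$, and set $a:=\beta_2/\beta_1$. Notation. Put $g_{\mu,\nu}(u):=u^{\mu-1}(1-u^2)^{\nu-1}$ for $0<u<1$, and let $h_{\mu,\nu}:\mathbb{R}\to\mathbb{R}$ be given by $$h_{\mu,\nu}(x):=\int_{|x|}^{1}(2u-|x|)\,g_{\mu,\nu}(u)\,g_{\mu,\nu}(u-|x|)\,du\quad(|x|<1),\qquad h_{\mu,\nu}(x):=0\quad(|x|\ge 1).$$ Put $$f_{\mu,\nu,\varepsilon,\beta_1,\beta_2}(x):=\beta_2^{\varepsilon}\,h_{\mu,\nu}\!\left(\frac{x}{\beta_2}\right)-\beta_1^{\varepsilon}\,h_{\mu,\nu}\!\left(\frac{x}{\beta_1}\right),\qquad x\in\mathbb{R}.$$ Let $\Phi_m$ be the class of continuous functions $\varphi:[0,\infty)\to\mathbb{R}$ such that $\varphi(\|x\|)$ is positive definite on the Euclidean space $\mathbb{R}^m$, i.e. $\sum_{i,j}c_i\overline{c_j}\,\varphi(\|x_i-x_j\|)\ge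 0$ for all finite families of points $x_i\in\mathbb{R}^m$ and coefficients $c_i\in\mathbb{C}$; membership of $f_{\mu,\nu,\varepsilon,\beta_1,\beta_2}$ in $\Phi_m$ refers to its restriction to $[0,\infty)$. A function $G:(0,\infty)\to\mathbb{R}$ is completely monotone if it is infinitely differentiable and $(-1)^nG^{(n)}(x)\ge 0$ for all integers $n\ge 0$ and all $x>0$. Theorem. One has $f_{\mu,\nu,\varepsilon,\beta_1,\beta_2}\in\Phi_m$ if and only if the function $$x\mapsto\frac{1}{x^{\mu}(1+x^2)^{\frac{m-1}{2}+\nu}}-\frac{a^{2\nu-1-\varepsilon}}{x^{\mu}(1+a^2x^2)^{\frac{m-1}{2}+\nu}}$$ is completely monotone on $(0,\infty)$. Moreover, if $f_{\mu,\nu,\varepsilon,\beta_1,\beta_2}\in\Phi_m$ and $\beta_2>\beta_1$, then $\varepsilon\ge 2\nu-1$. -/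

import Mathlib

open scoped ContDiff

noncomputable section

/-- A complex-valued function `F` on an additive group is positive definite if
`∑ i, ∑ j, c i * conj (c j) * F (x i - x j)` is a nonnegative real number for all finite families
of points `x i` and of complex coefficients `c i`. -/
def IsPositiveDefinite {E : Type*} [AddCommGroup E] (F : E → ℂ) : Prop :=
  ∀ (n : ℕ) (x : Fin n → E) (c : Fin n → ℂ),
    0 ≤ (∑ i, ∑ j, c i * (starRingEnd ℂ) (c j) * F (x i - x j)).re ∧
      (∑ i, ∑ j, c i * (starRingEnd ℂ) (c j) * F (x i - x j)).im = 0

/-- The class `Φ_m` of functions `φ`, continuous on `[0, ∞)`, such that `φ(‖x‖)` is positive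
definite on the Euclidean space `ℝ^m`. Only the values of `φ` on `[0, ∞)` matter. -/
def Phi (m : ℕ) : Set (ℝ → ℝ) :=
  {φ | ContinuousOn φ (Set.Ici 0) ∧
    IsPositiveDefinite (fun x : EuclideanSpace ℝ (Fin m) => ((φ ‖x‖ : ℝ) : ℂ))}

/-- Completely monotone functions on `(0, ∞)`. Only the values of `g` on `(0, ∞)` matter. -/
def CompletelyMonotone (g : ℝ → ℝ) : Prop :=
  ContDiffOn ℝ ∞ g (Set.Ioi 0) ∧
    ∀ (n : ℕ) (x : ℝ), 0 < x → 0 ≤ (-1 : ℝ) ^ n * iteratedDerivWithin n g (Set.Ioi 0) x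

/-- `g_{μ,ν}(u) = u^(μ-1) (1-u²)^(ν-1)`, used for `0 < u < 1`. -/
def gFun (μ ν u : ℝ) : ℝ := u ^ (μ - 1) * (1 - u ^ 2) ^ (ν - 1)

/-- Zastavnyi's function `h_{μ,ν}`. -/
def hFun (μ ν x : ℝ) : ℝ :=
  if |x| < 1 then ∫ u in |x|..1, (2 * u - |x|) * gFun μ ν u * gFun μ ν (u - |x|) else 0

/-- `f_{μ,ν,ε,β₁,β₂}(x) = β₂^ε h_{μ,ν}(x/β₂) - β₁^ε h_{μ,ν}(x/β₁)`. -/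
def fFun (μ ν ε β₁ β₂ x : ℝ) : ℝ :=
  β₂ ^ ε * hFun μ ν (x / β₂) - β₁ ^ ε * hFun μ ν (x / β₁)

end

/-!
The Fourier transform of `x ↦ fFun μ ν ε β₁ β₂ ‖x‖` on `ℝ^m` at `ξ` is a positive multiple of
`D (2 π β₂ ‖ξ‖)`, for a function `D` whose weighted Laplace transform is, up to a positive factor,
the function claimed to be completely monotone. Both sides of the equivalence then say that
`D ≥ 0`. Put `l = ν + (m - 1) / 2`.

The substitution `p = u (u - x)` in the integral defining `hFun` gives, for `0 ≤ x < 1`,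
`hFun μ ν x = ∫ (1 - s)^(μ-1) (s² - x²)^(ν-1) ds` over `x < s < 1`, a superposition of dilates of
the Bochner-Riesz kernel `(1 - r²)₊^(ν-1)` (`hFun_eq_integral_ballKernel`). The Fourier transform
of that kernel on `ℝ^m` is a positive multiple of `Ψ (2 π ‖ξ‖)` with
`Ψ v = ∫ (1 - y²)^(l-1) cos (v y) dy` over `|y| < 1` (`fourier_ballKernel_norm`). Hence the
Fourier transform of `hFun μ ν ‖x‖` is a positive multiple of `R (2 π ‖ξ‖)`, where
`R t = ∫ (1 - s)^(μ-1) s^(2l-1) Ψ (s t) ds` over `0 < s < 1` (`fourier_hFun_norm`).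

The function `t^(μ+2l-1) R t` is the convolution of `v^(2l-1) Ψ v` and `v^(μ-1)`. By Bessel's
equation for `Ψ`, the Laplace transform of the first factor satisfies a linear differential
equation of first order, which makes it a positive multiple of `(1 + p²)^(-l)`
(`exists_weightedLaplace_besselKernel`). So the Laplace transform of `t^(μ+2l-1) R t` is a
positive multiple of `p^(-μ) (1 + p²)^(-l)` (`weightedLaplace_radialTransform`), and dilating
gives the two terms of the statement, for `D t = R t - a^(-ε-m) R (t / a)`.

Two general facts conclude. A continuous integrable function is positive definite if and only if
its Fourier transform is nonnegative (`IsPositiveDefinite.fourier_re_nonneg`,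
`isPositiveDefinite_of_fourier_nonneg`). The Laplace transform of `t^σ D t`, for `D` continuous
and bounded, is completely monotone if and only if `D ≥ 0` on `(0, ∞)`
(`completelyMonotone_weightedLaplace_iff`); the direction that recovers `D` evaluates the
derivatives against Gamma densities concentrating at a point, as in the Post-Widder inversion
formula.

The inequality `2 ν - 1 ≤ ε` for `β₁ < β₂` comes from nonnegativity near `0` of the completely
monotone function.
-/

open MeasureTheory Set Filter Topology
open scoped ContDiff FourierTransform RealInnerProductSpace

/-! ### Laplace transforms and complete monotonicity -/

/-- The Laplace transform of `t ↦ t ^ σ * D t`. -/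
noncomputable def weightedLaplace (σ : ℝ) (D : ℝ → ℝ) (p : ℝ) : ℝ :=
  ∫ t in Ioi 0, t ^ σ * Real.exp (-(p * t)) * D t

theorem integrableOn_rpow_mul_exp {σ p : ℝ} (hσ : -1 < σ) (hp : 0 < p) :
    IntegrableOn (fun t : ℝ => t ^ σ * Real.exp (-(p * t))) (Ioi 0) := by
  simpa using integrableOn_rpow_mul_exp_neg_mul_rpow hσ one_pos hp

theorem integral_rpow_mul_exp {σ p : ℝ} (hσ : -1 < σ) (hp : 0 < p) :
    ∫ t in Ioi 0, t ^ σ * Real.exp (-(p * t)) = Real.Gamma (σ + 1) / p ^ (σ + 1) := by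
  have := Real.integral_rpow_mul_exp_neg_mul_Ioi (a := σ + 1) (by linarith) hp
  rw [add_sub_cancel_right] at this
  rw [this, Real.div_rpow zero_le_one hp.le, Real.one_rpow]
  ring

theorem integrableOn_weightedLaplace {σ p M : ℝ} {D : ℝ → ℝ} (hσ : -1 < σ) (hp : 0 < p)
    (hD : Continuous D) (hM : ∀ t, |D t| ≤ M) :
    IntegrableOn (fun t : ℝ => t ^ σ * Real.exp (-(p * t)) * D t) (Ioi 0) := by
  refine (integrableOn_rpow_mul_exp hσ hp).mul_bdd (c := M) ?_ ?_
  · exact hD.aestronglyMeasurable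
  · exact Eventually.of_forall fun t => by simpa using hM t

theorem hasDerivAt_weightedLaplace {σ p M : ℝ} {D : ℝ → ℝ} (hσ : -1 < σ) (hp : 0 < p)
    (hD : Continuous D) (hM : ∀ t, |D t| ≤ M) :
    HasDerivAt (weightedLaplace σ D) (-weightedLaplace (σ + 1) D p) p := by
  have key := hasDerivAt_integral_of_dominated_loc_of_deriv_le
    (μ := volume.restrict (Ioi (0 : ℝ)))
    (F := fun q t : ℝ => t ^ σ * Real.exp (-(q * t)) * D t)
    (F' := fun q t : ℝ => -(t ^ (σ + 1) * Real.exp (-(q * t)) * D t))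
    (x₀ := p) (s := Ioi (p / 2))
    (bound := fun t => t ^ (σ + 1) * Real.exp (-(p / 2 * t)) * M)
    (Ioi_mem_nhds (by linarith)) ?_ (integrableOn_weightedLaplace hσ hp hD hM) ?_ ?_
    ((integrableOn_rpow_mul_exp (by linarith) (by linarith)).mul_const M) ?_
  · have := key.2
    rwa [integral_neg] at this
  · filter_upwards [Ioi_mem_nhds hp] with q hq
    exact (integrableOn_weightedLaplace hσ hq hD hM).aestronglyMeasurable
  · exact (integrableOn_weightedLaplace (by linarith) hp hD hM).neg.aestronglyMeasurable
  · refine (ae_restrict_iff' measurableSet_Ioi).2 (Eventually.of_forall fun t ht q hq => ?_)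
    rw [mem_Ioi] at ht hq
    rw [norm_neg, norm_mul, norm_mul, Real.norm_of_nonneg (Real.rpow_nonneg ht.le _),
      Real.norm_of_nonneg (Real.exp_pos _).le]
    have := hM t
    gcongr
    exact this
  · refine (ae_restrict_iff' measurableSet_Ioi).2 (Eventually.of_forall fun t ht q hq => ?_)
    rw [mem_Ioi] at ht
    have h1 : HasDerivAt (fun q : ℝ => -(q * t)) (-t) q := by
      simpa using (hasDerivAt_mul_const t).fun_neg
    have h2 := ((h1.exp).const_mul (t ^ σ)).mul_const (D t)
    convert! h2 using 1
    rw [Real.rpow_add_one ht.ne']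
    ring

theorem iteratedDerivWithin_weightedLaplace {σ M : ℝ} {D : ℝ → ℝ} (hσ : -1 < σ)
    (hD : Continuous D) (hM : ∀ t, |D t| ≤ M) (n : ℕ) :
    EqOn (iteratedDerivWithin n (weightedLaplace σ D) (Ioi 0))
      (fun p => (-1) ^ n * weightedLaplace (σ + n) D p) (Ioi 0) := by
  induction n with
  | zero => intro p hp; simp
  | succ n ih =>
    intro p hp
    rw [iteratedDerivWithin_succ, derivWithin_congr ih (ih hp),
      derivWithin_of_isOpen isOpen_Ioi hp]
    have hn : -1 < σ + n := by linarith [n.cast_nonneg (α := ℝ)]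
    have := (hasDerivAt_weightedLaplace hn hp hD hM).const_mul
      ((-1 : ℝ) ^ n)
    rw [this.deriv]
    push_cast
    rw [pow_succ, add_assoc]
    ring

theorem contDiffOn_weightedLaplace {σ M : ℝ} {D : ℝ → ℝ} (hσ : -1 < σ)
    (hD : Continuous D) (hM : ∀ t, |D t| ≤ M) :
    ContDiffOn ℝ ∞ (weightedLaplace σ D) (Ioi 0) := by
  refine contDiffOn_of_differentiableOn_deriv fun n _ => ?_
  refine DifferentiableOn.congr ?_ (iteratedDerivWithin_weightedLaplace hσ hD hM n)
  intro p hp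
  have hn : -1 < σ + n := by linarith [n.cast_nonneg (α := ℝ)]
  have := (hasDerivAt_weightedLaplace hn hp hD hM).const_mul
      ((-1 : ℝ) ^ n)
  exact this.differentiableAt.differentiableWithinAt

/-- If all the weighted Laplace transforms of `D` with weights `t ^ (σ + n)` are nonnegative, then
so is `D`: tested against the Gamma density with mean `t` and variance `t ^ 2 / A`, where
`A = σ + n + 1`, the function `D` gives in the limit its value at `t`. -/
theorem nonneg_of_weightedLaplace_nonneg {σ M : ℝ} {D : ℝ → ℝ} (hσ : -1 < σ)
    (hD : Continuous D) (hM : ∀ t, |D t| ≤ M)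
    (hpos : ∀ (n : ℕ) (p : ℝ), 0 < p → 0 ≤ weightedLaplace (σ + n) D p) {t : ℝ} (ht : 0 < t) :
    0 ≤ D t := by
  by_contra! hneg
  -- near `t` the function `D` is below `D t / 2`, and elsewhere it is bounded
  obtain ⟨δ, hδ, hδD⟩ := Metric.continuous_iff.1 hD t (-(D t) / 2) (by linarith)
  have hM0 : 0 ≤ M := (abs_nonneg _).trans (hM 0)
  set K : ℝ := 2 * M / δ ^ 2 with hK
  have hK0 : 0 ≤ K := by positivity
  have hle : ∀ v, D v ≤ D t / 2 + K * (v - t) ^ 2 := by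
    intro v
    by_cases hv : dist v t < δ
    · have h1 := hδD v hv
      rw [Real.dist_eq, abs_lt] at h1
      have : 0 ≤ K * (v - t) ^ 2 := by positivity
      linarith [h1.2]
    · rw [Real.dist_eq, not_lt] at hv
      have h1 : δ ^ 2 ≤ (v - t) ^ 2 := by
        rw [← sq_abs (v - t)]
        gcongr
      have h2 : 2 * M ≤ K * (v - t) ^ 2 := by
        rw [hK, div_mul_eq_mul_div, le_div_iff₀ (by positivity)]
        gcongr
      have h3 := (abs_le.1 (hM t)).1
      have h4 := (abs_le.1 (hM v)).2
      linarith
  obtain ⟨n, hn⟩ := exists_nat_gt (2 * K * t ^ 2 / (-(D t)))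
  rw [div_lt_iff₀ (by linarith)] at hn
  set A : ℝ := σ + n + 1 with hA
  have hnA : (n : ℝ) < A := by linarith
  have hA0 : 0 < A := lt_of_le_of_lt (Nat.cast_nonneg n) hnA
  set p : ℝ := A / t with hp
  have hp0 : 0 < p := by positivity
  have hσn : -1 < σ + n := by linarith
  set w : ℝ → ℝ := fun v => v ^ (σ + n) * Real.exp (-(p * v)) with hw
  set Z : ℝ := Real.Gamma A / p ^ A with hZ
  have hZ0 : 0 < Z := div_pos (Real.Gamma_pos_of_pos hA0) (Real.rpow_pos_of_pos hp0 _)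
  have i0 : IntegrableOn w (Ioi 0) := integrableOn_rpow_mul_exp hσn hp0
  have e0 : ∫ v in Ioi 0, w v = Z := integral_rpow_mul_exp hσn hp0
  have c1 : EqOn (fun v : ℝ => v ^ (σ + n + 1) * Real.exp (-(p * v))) (fun v => w v * v)
      (Ioi 0) := by
    intro v hv
    simp only [hw]
    rw [Real.rpow_add_one (ne_of_gt hv)]
    ring
  have c2 : EqOn (fun v : ℝ => v ^ (σ + n + 1 + 1) * Real.exp (-(p * v))) (fun v => w v * v ^ 2)
      (Ioi 0) := by
    intro v hv
    simp only [hw]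
    rw [Real.rpow_add_one (ne_of_gt hv), Real.rpow_add_one (ne_of_gt hv)]
    ring
  have i1 : IntegrableOn (fun v => w v * v) (Ioi 0) :=
    (integrableOn_rpow_mul_exp (by linarith) hp0).congr_fun c1 measurableSet_Ioi
  have i2 : IntegrableOn (fun v => w v * v ^ 2) (Ioi 0) :=
    (integrableOn_rpow_mul_exp (by linarith) hp0).congr_fun c2 measurableSet_Ioi
  have e1 : ∫ v in Ioi 0, w v * v = Z * t := by
    rw [← setIntegral_congr_fun measurableSet_Ioi c1, integral_rpow_mul_exp (by linarith) hp0,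
      ← hA, Real.Gamma_add_one hA0.ne', Real.rpow_add_one hp0.ne', hZ, hp]
    field_simp
  have e2 : ∫ v in Ioi 0, w v * v ^ 2 = Z * (t ^ 2 * (A + 1) / A) := by
    rw [← setIntegral_congr_fun measurableSet_Ioi c2, integral_rpow_mul_exp (by linarith) hp0,
      ← hA, Real.Gamma_add_one (by positivity), Real.Gamma_add_one hA0.ne',
      Real.rpow_add_one hp0.ne', Real.rpow_add_one hp0.ne', hZ, hp]
    field_simp
  have i3 : IntegrableOn (fun v => (D t / 2 + K * t ^ 2) * w v - 2 * K * t * (w v * v)) (Ioi 0) :=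
    (i0.const_mul _).sub (i1.const_mul _)
  have h1 : ∫ v in Ioi 0, w v * D v ≤
      ∫ v in Ioi 0, ((D t / 2 + K * t ^ 2) * w v - 2 * K * t * (w v * v) + K * (w v * v ^ 2)) := by
    refine setIntegral_mono_on (integrableOn_weightedLaplace hσn hp0 hD hM)
      (i3.add (i2.const_mul _)) measurableSet_Ioi ?_
    intro v hv
    have hw0 : 0 ≤ w v := mul_nonneg (Real.rpow_nonneg (le_of_lt hv) _) (Real.exp_pos _).le
    calc w v * D v ≤ w v * (D t / 2 + K * (v - t) ^ 2) := by gcongr; exact hle v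
      _ = _ := by ring
  rw [integral_add i3 (i2.const_mul _),
    integral_sub (i0.const_mul _) (i1.const_mul _), integral_const_mul, integral_const_mul,
    integral_const_mul, e0, e1, e2] at h1
  have h2 : 0 ≤ ∫ v in Ioi 0, w v * D v := hpos n p hp0
  have h3 : (D t / 2 + K * t ^ 2) * Z - 2 * K * t * (Z * t) + K * (Z * (t ^ 2 * (A + 1) / A)) =
      Z * (D t / 2 + K * t ^ 2 / A) := by
    field_simp
    ring
  rw [h3] at h1
  have h4 : K * t ^ 2 / A < -(D t) / 2 := by
    rw [div_lt_iff₀ hA0]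
    nlinarith
  have h5 : Z * (D t / 2 + K * t ^ 2 / A) < 0 := mul_neg_of_pos_of_neg hZ0 (by linarith)
  linarith

/-- A weighted Laplace transform is completely monotone exactly when its density is nonnegative. -/
theorem completelyMonotone_weightedLaplace_iff {σ M : ℝ} {D : ℝ → ℝ} (hσ : -1 < σ)
    (hD : Continuous D) (hM : ∀ t, |D t| ≤ M) :
    CompletelyMonotone (weightedLaplace σ D) ↔ ∀ t, 0 < t → 0 ≤ D t := by
  have key : ∀ (n : ℕ) (p : ℝ), 0 < p →
      (-1 : ℝ) ^ n * iteratedDerivWithin n (weightedLaplace σ D) (Ioi 0) p =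
        weightedLaplace (σ + n) D p := by
    intro n p hp
    rw [iteratedDerivWithin_weightedLaplace hσ hD hM n hp, ← mul_assoc, ← mul_pow]
    simp
  constructor
  · rintro ⟨-, h⟩ t ht
    exact nonneg_of_weightedLaplace_nonneg hσ hD hM
      (fun n p hp => key n p hp ▸ h n p hp) ht
  · refine fun h => ⟨contDiffOn_weightedLaplace hσ hD hM, fun n p hp => ?_⟩
    rw [key n p hp]
    refine setIntegral_nonneg measurableSet_Ioi fun t ht => ?_
    exact mul_nonneg (mul_nonneg (Real.rpow_nonneg (le_of_lt ht) _) (Real.exp_pos _).le) (h t ht)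

theorem CompletelyMonotone.congr {f g : ℝ → ℝ} (hf : CompletelyMonotone f)
    (h : EqOn g f (Ioi 0)) : CompletelyMonotone g :=
  ⟨hf.1.congr h, fun n x hx => by rw [iteratedDerivWithin_congr h hx]; exact hf.2 n x hx⟩

theorem CompletelyMonotone.const_mul {f : ℝ → ℝ} (hf : CompletelyMonotone f) {c : ℝ}
    (hc : 0 ≤ c) : CompletelyMonotone fun x => c * f x := by
  refine ⟨contDiffOn_const.mul hf.1, fun n x hx => ?_⟩
  rw [iteratedDerivWithin_const_mul_field, mul_left_comm]
  exact mul_nonneg hc (hf.2 n x hx)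

/-! ### The Bessel kernel and its Laplace transform -/

theorem integrableOn_rpow_mul_one_sub_rpow {a b : ℝ} (ha : 0 < a) (hb : 0 < b) :
    IntegrableOn (fun x : ℝ => x ^ (a - 1) * (1 - x) ^ (b - 1)) (Ioo 0 1) := by
  have h := Complex.betaIntegral_convergent (u := a) (v := b) (by simpa) (by simpa)
  rw [intervalIntegrable_iff_integrableOn_Ioo_of_le zero_le_one] at h
  refine IntegrableOn.congr_fun h.re (fun x hx => ?_) measurableSet_Ioo
  have h1 : (0 : ℝ) ≤ 1 - x := by linarith [hx.2]
  have : (x : ℂ) ^ ((a : ℂ) - 1) * (1 - (x : ℂ)) ^ ((b : ℂ) - 1) =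
      ((x ^ (a - 1) * (1 - x) ^ (b - 1) : ℝ) : ℂ) := by
    rw [Complex.ofReal_mul, Complex.ofReal_cpow hx.1.le, Complex.ofReal_cpow h1]
    push_cast
    rfl
  rw [this]
  exact Complex.ofReal_re _

theorem integrableOn_one_sub_sq_rpow {l : ℝ} (hl : 0 < l) :
    IntegrableOn (fun y : ℝ => (1 - y ^ 2) ^ (l - 1)) (Ioo (-1) 1) := by
  have h := integrableOn_rpow_mul_one_sub_rpow hl hl
  rw [← intervalIntegrable_iff_integrableOn_Ioo_of_le zero_le_one] at h
  have h2 := (h.comp_mul_left (c := 1 / 2)).comp_add_right 1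
  norm_num at h2
  rw [intervalIntegrable_iff_integrableOn_Ioo_of_le (by norm_num)] at h2
  refine IntegrableOn.congr_fun (h2.const_mul (4 ^ (l - 1))) (fun x hx => ?_) measurableSet_Ioo
  have h3 : (0 : ℝ) ≤ 1 / 2 * (x + 1) := by linarith [hx.1]
  have h4 : (0 : ℝ) ≤ 1 - 1 / 2 * (x + 1) := by linarith [hx.2]
  rw [← Real.mul_rpow h3 h4, ← Real.mul_rpow (by norm_num) (mul_nonneg h3 h4)]
  ring_nf

/-- The even entire function `v ↦ ∫ (1 - y²)^(l-1) cos (v y) dy` on `(-1, 1)`. Up to a constant it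
is `v^(1/2-l) J_{l-1/2}(v)` with a Bessel function `J`. -/
noncomputable def besselKernel (l v : ℝ) : ℝ :=
  ∫ y in Ioo (-1 : ℝ) 1, (1 - y ^ 2) ^ (l - 1) * Real.cos (v * y)

section TrigonometricIntegrals

variable {w : ℝ → ℝ} (hw : IntegrableOn w (Ioo (-1) 1))
include hw

theorem integrableOn_mul_bounded {g : ℝ → ℝ} (hg : Continuous g) :
    IntegrableOn (fun y => w y * g y) (Ioo (-1) 1) := by
  obtain ⟨C, hC⟩ := (isCompact_Icc (a := (-1 : ℝ)) (b := 1)).exists_bound_of_continuousOn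
    hg.continuousOn
  refine hw.mul_bdd (c := C) hg.aestronglyMeasurable ?_
  refine (ae_restrict_iff' measurableSet_Ioo).2 (Eventually.of_forall fun y hy => ?_)
  exact hC y (Ioo_subset_Icc_self hy)

theorem hasDerivAt_integral_mul_cos (v : ℝ) :
    HasDerivAt (fun v => ∫ y in Ioo (-1 : ℝ) 1, w y * Real.cos (v * y))
      (-∫ y in Ioo (-1 : ℝ) 1, w y * y * Real.sin (v * y)) v := by
  have key := hasDerivAt_integral_of_dominated_loc_of_deriv_le
    (μ := volume.restrict (Ioo (-1 : ℝ) 1))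
    (F := fun v y : ℝ => w y * Real.cos (v * y))
    (F' := fun v y : ℝ => -(w y * y * Real.sin (v * y)))
    (x₀ := v) (s := univ) (bound := fun y => |w y|) univ_mem
    (Eventually.of_forall fun v => (integrableOn_mul_bounded hw
      (by fun_prop : Continuous fun y => Real.cos (v * y))).aestronglyMeasurable)
    (integrableOn_mul_bounded hw (by fun_prop)) ?_ ?_ hw.abs ?_
  · have := key.2
    rwa [integral_neg] at this
  · have := (integrableOn_mul_bounded hw
      (by fun_prop : Continuous fun y => y * Real.sin (v * y))).neg.aestronglyMeasurable
    refine this.congr (Eventually.of_forall fun y => ?_)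
    simp [mul_assoc]
  · refine (ae_restrict_iff' measurableSet_Ioo).2 (Eventually.of_forall fun y hy v _ => ?_)
    rw [norm_neg, norm_mul, norm_mul, Real.norm_eq_abs, mul_assoc]
    refine mul_le_of_le_one_right (abs_nonneg _) (mul_le_one₀ ?_ (norm_nonneg _) ?_)
    · exact abs_le.2 ⟨hy.1.le, hy.2.le⟩
    · exact Real.abs_sin_le_one _
  · refine Eventually.of_forall fun y v _ => ?_
    have := ((hasDerivAt_mul_const (x := v) y).cos).const_mul (w y)
    convert! this using 1
    ring

theorem hasDerivAt_integral_mul_sin (v : ℝ) :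
    HasDerivAt (fun v => ∫ y in Ioo (-1 : ℝ) 1, w y * Real.sin (v * y))
      (∫ y in Ioo (-1 : ℝ) 1, w y * y * Real.cos (v * y)) v := by
  have key := hasDerivAt_integral_of_dominated_loc_of_deriv_le
    (μ := volume.restrict (Ioo (-1 : ℝ) 1))
    (F := fun v y : ℝ => w y * Real.sin (v * y))
    (F' := fun v y : ℝ => w y * y * Real.cos (v * y))
    (x₀ := v) (s := univ) (bound := fun y => |w y|) univ_mem
    (Eventually.of_forall fun v => (integrableOn_mul_bounded hw
      (by fun_prop : Continuous fun y => Real.sin (v * y))).aestronglyMeasurable)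
    (integrableOn_mul_bounded hw (by fun_prop)) ?_ ?_ hw.abs ?_
  · exact key.2
  · have := (integrableOn_mul_bounded hw
      (by fun_prop : Continuous fun y => y * Real.cos (v * y))).aestronglyMeasurable
    refine this.congr (Eventually.of_forall fun y => ?_)
    simp [mul_assoc]
  · refine (ae_restrict_iff' measurableSet_Ioo).2 (Eventually.of_forall fun y hy v _ => ?_)
    rw [norm_mul, norm_mul, Real.norm_eq_abs, mul_assoc]
    refine mul_le_of_le_one_right (abs_nonneg _) (mul_le_one₀ ?_ (norm_nonneg _) ?_)
    · exact abs_le.2 ⟨hy.1.le, hy.2.le⟩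
    · exact Real.abs_cos_le_one _
  · refine Eventually.of_forall fun y v _ => ?_
    have := ((hasDerivAt_mul_const (x := v) y).sin).const_mul (w y)
    convert! this using 1
    ring

theorem abs_integral_mul_le {g : ℝ → ℝ} (hg : ∀ y ∈ Ioo (-1 : ℝ) 1, |g y| ≤ 1) :
    |∫ y in Ioo (-1 : ℝ) 1, w y * g y| ≤ ∫ y in Ioo (-1 : ℝ) 1, |w y| := by
  rw [← Real.norm_eq_abs]
  refine norm_integral_le_of_norm_le hw.abs ?_
  refine (ae_restrict_iff' measurableSet_Ioo).2 (Eventually.of_forall fun y hy => ?_)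
  rw [norm_mul]
  exact mul_le_of_le_one_right (abs_nonneg _) (hg y hy)

end TrigonometricIntegrals

/-- The negative of the derivative of `besselKernel l`. -/
noncomputable def besselKernelNegDeriv (l v : ℝ) : ℝ :=
  ∫ y in Ioo (-1 : ℝ) 1, (1 - y ^ 2) ^ (l - 1) * y * Real.sin (v * y)

theorem hasDerivAt_besselKernel {l : ℝ} (hl : 0 < l) (v : ℝ) :
    HasDerivAt (besselKernel l) (-besselKernelNegDeriv l v) v :=
  hasDerivAt_integral_mul_cos (integrableOn_one_sub_sq_rpow hl) v

theorem continuous_besselKernel {l : ℝ} (hl : 0 < l) : Continuous (besselKernel l) :=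
  continuous_iff_continuousAt.2 fun v => (hasDerivAt_besselKernel hl v).continuousAt

theorem besselKernel_zero_pos {l : ℝ} (hl : 0 < l) : 0 < besselKernel l 0 := by
  have hpos : ∀ y ∈ Ioo (-1 : ℝ) 1, 0 < 1 - y ^ 2 := fun y hy => by nlinarith [hy.1, hy.2]
  have : besselKernel l 0 = ∫ y in Ioo (-1 : ℝ) 1, (1 - y ^ 2) ^ (l - 1) := by
    simp [besselKernel]
  rw [this, setIntegral_pos_iff_support_of_nonneg_ae ?_ (integrableOn_one_sub_sq_rpow hl)]
  · have : Ioo (-1 : ℝ) 1 ⊆ Function.support (fun y : ℝ => (1 - y ^ 2) ^ (l - 1)) :=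
      fun y hy => (Real.rpow_pos_of_pos (hpos y hy) _).ne'
    rw [inter_eq_self_of_subset_right this]
    simp
  · refine (ae_restrict_iff' measurableSet_Ioo).2 (Eventually.of_forall fun y hy => ?_)
    exact Real.rpow_nonneg (hpos y hy).le _

theorem abs_besselKernel_le {l : ℝ} (hl : 0 < l) (v : ℝ) :
    |besselKernel l v| ≤ besselKernel l 0 := by
  refine (abs_integral_mul_le (integrableOn_one_sub_sq_rpow hl)
    (fun y _ => Real.abs_cos_le_one _)).trans_eq ?_
  refine setIntegral_congr_fun measurableSet_Ioo fun y hy => ?_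
  have : 0 ≤ 1 - y ^ 2 := by nlinarith [hy.1, hy.2]
  simp [abs_of_nonneg (Real.rpow_nonneg this _)]

theorem abs_besselKernelNegDeriv_le {l : ℝ} (hl : 0 < l) (v : ℝ) :
    |besselKernelNegDeriv l v| ≤ besselKernel l 0 := by
  have := abs_integral_mul_le (integrableOn_one_sub_sq_rpow hl)
    (g := fun y => y * Real.sin (v * y)) (fun y hy => by
      rw [abs_mul]
      exact mul_le_one₀ (abs_le.2 ⟨hy.1.le, hy.2.le⟩) (abs_nonneg _) (Real.abs_sin_le_one _))
  simp only [← mul_assoc] at this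
  refine this.trans_eq ?_
  refine setIntegral_congr_fun measurableSet_Ioo fun y hy => ?_
  have : 0 ≤ 1 - y ^ 2 := by nlinarith [hy.1, hy.2]
  simp [abs_of_nonneg (Real.rpow_nonneg this _)]

/-- Bessel's differential equation `v (Ψ + Ψ'') + 2 l Ψ' = 0` for `Ψ = besselKernel l`. It comes
from integrating the derivative of `(1 - y²)^l sin (v y)` over `(-1, 1)`. -/
theorem mul_hasDerivAt_besselKernelNegDeriv {l : ℝ} (hl : 0 < l) (v : ℝ) :
    ∃ d : ℝ, HasDerivAt (besselKernelNegDeriv l) d v ∧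
      v * (besselKernel l v - d) = 2 * l * besselKernelNegDeriv l v := by
  have hw := integrableOn_one_sub_sq_rpow hl
  have hwy : IntegrableOn (fun y : ℝ => (1 - y ^ 2) ^ (l - 1) * y) (Ioo (-1) 1) :=
    integrableOn_mul_bounded hw continuous_id
  refine ⟨_, hasDerivAt_integral_mul_sin hwy v, ?_⟩
  have i1 : IntegrableOn (fun y : ℝ => (1 - y ^ 2) ^ (l - 1) * Real.cos (v * y)) (Ioo (-1) 1) :=
    integrableOn_mul_bounded hw (by fun_prop)
  have i2 : IntegrableOn (fun y : ℝ => (1 - y ^ 2) ^ (l - 1) * y * y * Real.cos (v * y))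
      (Ioo (-1) 1) :=
    integrableOn_mul_bounded (integrableOn_mul_bounded hwy continuous_id) (by fun_prop)
  have i3 : IntegrableOn (fun y : ℝ => (1 - y ^ 2) ^ (l - 1) * y * Real.sin (v * y)) (Ioo (-1) 1) :=
    integrableOn_mul_bounded hwy (by fun_prop)
  have i12 : IntegrableOn (fun y : ℝ => v * ((1 - y ^ 2) ^ (l - 1) * Real.cos (v * y) -
      (1 - y ^ 2) ^ (l - 1) * y * y * Real.cos (v * y))) (Ioo (-1) 1) := (i1.sub i2).const_mul v
  have hint : IntegrableOn (fun y : ℝ => v * ((1 - y ^ 2) ^ (l - 1) * Real.cos (v * y) -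
      (1 - y ^ 2) ^ (l - 1) * y * y * Real.cos (v * y)) -
      2 * l * ((1 - y ^ 2) ^ (l - 1) * y * Real.sin (v * y))) (Ioo (-1) 1) :=
    i12.sub (i3.const_mul (2 * l))
  have hftc := intervalIntegral.integral_eq_sub_of_hasDerivAt_of_le
    (a := (-1 : ℝ)) (b := 1) (f := fun y : ℝ => (1 - y ^ 2) ^ l * Real.sin (v * y))
    (f' := fun y : ℝ => v * ((1 - y ^ 2) ^ (l - 1) * Real.cos (v * y) -
      (1 - y ^ 2) ^ (l - 1) * y * y * Real.cos (v * y)) -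
      2 * l * ((1 - y ^ 2) ^ (l - 1) * y * Real.sin (v * y)))
    (by norm_num) ?_ ?_ ?_
  · rw [intervalIntegral.integral_of_le (by norm_num), integral_Ioc_eq_integral_Ioo] at hftc
    rw [integral_sub i12 (i3.const_mul (2 * l)), integral_const_mul,
      integral_const_mul, integral_sub i1 i2] at hftc
    norm_num [Real.zero_rpow hl.ne'] at hftc
    unfold besselKernel besselKernelNegDeriv
    linarith
  · refine ContinuousOn.mul (ContinuousOn.rpow_const (by fun_prop) fun y _ => Or.inr hl.le) ?_
    fun_prop
  · intro y hy
    have hpos : 0 < 1 - y ^ 2 := by nlinarith [hy.1, hy.2]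
    have h1 : HasDerivAt (fun y : ℝ => 1 - y ^ 2) (-(2 * y)) y := by
      simpa using (hasDerivAt_pow 2 y).const_sub 1
    have h2 := (h1.rpow_const (p := l) (Or.inl hpos.ne')).mul
      ((hasDerivAt_const_mul (x := y) v).sin)
    convert! h2 using 1
    have h3 : (1 - y ^ 2) ^ l = (1 - y ^ 2) ^ (l - 1) * (1 - y ^ 2) := by
      rw [← Real.rpow_add_one hpos.ne', sub_add_cancel]
    rw [h3]
    ring
  · rw [intervalIntegrable_iff_integrableOn_Ioo_of_le (by norm_num)]
    exact hint

/-- The differential equation for the Laplace transform of `v^(2l-1) Ψ(v)`, with `Ψ` the Bessel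
kernel: `e^(-pv) v^(2l) (Ψ' + p Ψ)` is a primitive of the difference of the two integrands. -/
theorem one_add_sq_mul_weightedLaplace_besselKernel {l p : ℝ} (hl : 0 < l) (hp : 0 < p) :
    (1 + p ^ 2) * weightedLaplace (2 * l) (besselKernel l) p =
      2 * l * p * weightedLaplace (2 * l - 1) (besselKernel l) p := by
  have hc := continuous_besselKernel hl
  have i1 := integrableOn_weightedLaplace (σ := 2 * l) (by linarith) hp hc (abs_besselKernel_le hl)
  have i2 := integrableOn_weightedLaplace (σ := 2 * l - 1) (by linarith) hp hc
    (abs_besselKernel_le hl)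
  have hcd : Continuous (besselKernelNegDeriv l) := continuous_iff_continuousAt.2 fun v =>
    (mul_hasDerivAt_besselKernelNegDeriv hl v).choose_spec.1.continuousAt
  have hftc := integral_Ioi_of_hasDerivAt_of_tendsto (a := (0 : ℝ)) (m := 0)
    (f := fun v : ℝ => v ^ (2 * l) * Real.exp (-(p * v)) *
      (p * besselKernel l v - besselKernelNegDeriv l v))
    (f' := fun v : ℝ => 2 * l * p * (v ^ (2 * l - 1) * Real.exp (-(p * v)) * besselKernel l v) -
      (1 + p ^ 2) * (v ^ (2 * l) * Real.exp (-(p * v)) * besselKernel l v)) ?_ ?_ ?_ ?_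
  · rw [integral_sub (i2.const_mul _) (i1.const_mul _), integral_const_mul,
      integral_const_mul, Real.zero_rpow (by positivity)] at hftc
    unfold weightedLaplace
    linarith
  · refine ContinuousAt.continuousWithinAt (ContinuousAt.mul (ContinuousAt.mul ?_ ?_) ?_)
    · exact Real.continuousAt_rpow_const _ _ (Or.inr (by positivity))
    · fun_prop
    · exact (by fun_prop : Continuous _).continuousAt
  · intro v hv
    rw [mem_Ioi] at hv
    obtain ⟨d, hd, hode⟩ := mul_hasDerivAt_besselKernelNegDeriv hl v
    have h0 : HasDerivAt (fun v : ℝ => -(p * v)) (-p) v := by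
      simpa using (hasDerivAt_const_mul (x := v) p).fun_neg
    have h1 := ((Real.hasDerivAt_rpow_const (x := v) (p := 2 * l) (Or.inl hv.ne')).mul h0.exp).mul
      (((hasDerivAt_besselKernel hl v).const_mul p).sub hd)
    convert! h1 using 1
    have h3 : v ^ (2 * l) = v ^ (2 * l - 1) * v := by
      rw [← Real.rpow_add_one hv.ne', sub_add_cancel]
    simp only [Pi.mul_apply, Pi.sub_apply, h3]
    linear_combination (-(v ^ (2 * l - 1) * Real.exp (-(p * v)))) * hode
  · exact (i2.const_mul _).sub (i1.const_mul _)
  · have h1 : Tendsto (fun v : ℝ => v ^ (2 * l) * Real.exp (-(p * v))) atTop (𝓝 0) := by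
      simpa using tendsto_rpow_mul_exp_neg_mul_atTop_nhds_zero (2 * l) p hp
    refine h1.zero_mul_isBoundedUnder_le ?_
    refine isBoundedUnder_of ⟨p * besselKernel l 0 + besselKernel l 0, fun v => ?_⟩
    simp only [Function.comp, Real.norm_eq_abs]
    refine (abs_sub _ _).trans ?_
    rw [abs_mul, abs_of_pos hp]
    gcongr
    · exact abs_besselKernel_le hl v
    · exact abs_besselKernelNegDeriv_le hl v

/-- The Laplace transform of `v^(2l-1) Ψ(v)`, for the Bessel kernel `Ψ`, is a positive multiple of
`(1 + p²)^(-l)`. -/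
theorem exists_weightedLaplace_besselKernel {l : ℝ} (hl : 0 < l) :
    ∃ C : ℝ, 0 < C ∧ ∀ p, 0 < p →
      weightedLaplace (2 * l - 1) (besselKernel l) p = C / (1 + p ^ 2) ^ l := by
  have hc := continuous_besselKernel hl
  set L := weightedLaplace (2 * l - 1) (besselKernel l) with hL
  have hpos : ∀ p : ℝ, 0 < 1 + p ^ 2 := fun p => by positivity
  have hderiv : ∀ p ∈ Ioi (0 : ℝ), HasDerivAt (fun p => L p * (1 + p ^ 2) ^ l) 0 p := by
    intro p hp
    have h1 := hasDerivAt_weightedLaplace (σ := 2 * l - 1) (by linarith) hp hc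
      (abs_besselKernel_le hl)
    have h2 : HasDerivAt (fun p : ℝ => 1 + p ^ 2) (2 * p) p := by
      simpa using (hasDerivAt_pow 2 p).const_add 1
    convert! h1.mul (h2.rpow_const (p := l) (Or.inl (hpos p).ne')) using 1
    have h3 : (1 + p ^ 2) ^ l = (1 + p ^ 2) ^ (l - 1) * (1 + p ^ 2) := by
      rw [← Real.rpow_add_one (hpos p).ne', sub_add_cancel]
    have h4 := one_add_sq_mul_weightedLaplace_besselKernel hl hp
    rw [sub_add_cancel, h3]
    linear_combination (1 + p ^ 2) ^ (l - 1) * h4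
  obtain ⟨C, hC⟩ := isOpen_Ioi.exists_is_const_of_deriv_eq_zero (convex_Ioi (0 : ℝ)).isPreconnected
    (fun p hp => (hderiv p hp).differentiableAt.differentiableWithinAt)
    (fun p hp => (hderiv p hp).deriv)
  have hLC : ∀ p, 0 < p → L p = C / (1 + p ^ 2) ^ l := fun p hp => by
    rw [eq_div_iff (Real.rpow_pos_of_pos (hpos p) _).ne']
    exact hC p hp
  refine ⟨C, ?_, hLC⟩
  -- positivity of the constant, from `Ψ(v) ≥ Ψ(0) (1 - v² / 2)` and a large enough `p`
  have hw := integrableOn_one_sub_sq_rpow hl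
  have hlow : ∀ v, besselKernel l 0 * (1 - v ^ 2 / 2) ≤ besselKernel l v := by
    intro v
    have : besselKernel l 0 * (1 - v ^ 2 / 2) =
        ∫ y in Ioo (-1 : ℝ) 1, (1 - y ^ 2) ^ (l - 1) * (1 - v ^ 2 / 2) := by
      rw [integral_mul_const]
      simp [besselKernel]
    rw [this]
    refine setIntegral_mono_on (hw.mul_const _) (integrableOn_mul_bounded hw (by fun_prop))
      measurableSet_Ioo fun y hy => ?_
    have h0 : 0 ≤ 1 - y ^ 2 := by nlinarith [hy.1, hy.2]
    have h1 := Real.rpow_nonneg h0 (l - 1)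
    have h2 := Real.one_sub_sq_div_two_le_cos (x := v * y)
    gcongr
    nlinarith [sq_nonneg v]
  set p : ℝ := √(2 * l * (2 * l + 1)) with hp
  have hp0 : 0 < p := Real.sqrt_pos.2 (by positivity)
  have hp2 : p ^ 2 = 2 * l * (2 * l + 1) := Real.sq_sqrt (by positivity)
  have j0 := integrableOn_rpow_mul_exp (σ := 2 * l - 1) (by linarith) hp0
  have j2 := integrableOn_rpow_mul_exp (σ := 2 * l + 1) (by linarith) hp0
  have hLp : 0 < L p := by
    have h1 : ∫ v in Ioi 0, (besselKernel l 0 * (v ^ (2 * l - 1) * Real.exp (-(p * v))) -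
        besselKernel l 0 / 2 * (v ^ (2 * l + 1) * Real.exp (-(p * v)))) ≤ L p := by
      refine setIntegral_mono_on ((j0.const_mul _).sub (j2.const_mul _))
        (integrableOn_weightedLaplace (by linarith) hp0 hc (abs_besselKernel_le hl))
        measurableSet_Ioi fun v hv => ?_
      rw [mem_Ioi] at hv
      have h2 : v ^ (2 * l + 1) = v ^ (2 * l - 1) * v ^ 2 := by
        rw [← Real.rpow_natCast, ← Real.rpow_add hv]
        norm_num
        ring_nf
      have h3 : 0 ≤ v ^ (2 * l - 1) * Real.exp (-(p * v)) := by positivity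
      rw [h2]
      nlinarith [mul_le_mul_of_nonneg_left (hlow v) h3]
    refine lt_of_lt_of_le ?_ h1
    rw [integral_sub (j0.const_mul _) (j2.const_mul _), integral_const_mul, integral_const_mul,
      integral_rpow_mul_exp (by linarith) hp0, integral_rpow_mul_exp (by linarith) hp0,
      sub_add_cancel, Real.Gamma_add_one (by positivity), Real.Gamma_add_one (by positivity),
      Real.rpow_add_one hp0.ne', Real.rpow_add_one hp0.ne']
    have hG := Real.Gamma_pos_of_pos (s := 2 * l) (by positivity)
    have hP := Real.rpow_pos_of_pos hp0 (2 * l)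
    have hB := besselKernel_zero_pos hl
    have : besselKernel l 0 * (Real.Gamma (2 * l) / p ^ (2 * l)) -
        besselKernel l 0 / 2 * ((2 * l + 1) * (2 * l * Real.Gamma (2 * l)) /
          (p ^ (2 * l) * p * p)) =
        besselKernel l 0 * (Real.Gamma (2 * l) / p ^ (2 * l)) / 2 := by
      rw [mul_assoc (p ^ (2 * l)), ← sq, hp2]
      field_simp
      ring
    rw [this]
    positivity
  rw [hLC p hp0] at hLp
  by_contra hC0
  exact absurd hLp (not_lt.2 (div_nonpos_of_nonpos_of_nonneg (not_lt.1 hC0)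
    (Real.rpow_pos_of_pos (hpos p) _).le))

/-! ### The function `hFun` -/

theorem hFun_abs (μ ν x : ℝ) : hFun μ ν |x| = hFun μ ν x := by
  simp [hFun]

theorem hFun_of_one_le (μ ν : ℝ) {x : ℝ} (hx : 1 ≤ |x|) : hFun μ ν x = 0 := by
  simp [hFun, not_lt.2 hx]

theorem image_mul_sub_Ioo {x : ℝ} (hx0 : 0 ≤ x) :
    (fun u : ℝ => u * (u - x)) '' Ioo x 1 = Ioo 0 (1 - x) := by
  ext p
  constructor
  · rintro ⟨u, ⟨h1, h2⟩, rfl⟩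
    have h3 : 0 < u := lt_of_le_of_lt hx0 h1
    constructor
    · exact mul_pos h3 (by linarith)
    · change u * (u - x) < 1 - x
      nlinarith
  · rintro ⟨h1, h2⟩
    have hr := Real.sq_sqrt (show 0 ≤ x ^ 2 + 4 * p by positivity)
    refine ⟨(x + √(x ^ 2 + 4 * p)) / 2, ⟨?_, ?_⟩, ?_⟩
    · have : x < √(x ^ 2 + 4 * p) := Real.lt_sqrt_of_sq_lt (by linarith)
      linarith
    · have : √(x ^ 2 + 4 * p) < 2 - x := by
        rw [Real.sqrt_lt' (by linarith)]
        nlinarith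
      linarith
    · change _ * (_ - x) = p
      linear_combination hr / 4

/-- The substitution `p = u (u - x)`: it turns `(1 - u²) (1 - (u - x)²)` into `(1 - p)² - x²`. -/
theorem hFun_eq_setIntegral (μ ν : ℝ) {x : ℝ} (hx0 : 0 ≤ x) (hx1 : x < 1) :
    hFun μ ν x = ∫ p in Ioo 0 (1 - x), p ^ (μ - 1) * ((1 - p) ^ 2 - x ^ 2) ^ (ν - 1) := by
  have hinj : InjOn (fun u : ℝ => u * (u - x)) (Ioo x 1) := by
    intro u hu v hv huv
    simp only at huv
    have h1 : (u - v) * (u + v - x) = 0 := by linear_combination huv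
    rcases mul_eq_zero.1 h1 with h | h
    · linarith
    · linarith [hu.1, hv.1]
  have hder : ∀ u ∈ Ioo x 1,
      HasDerivWithinAt (fun u : ℝ => u * (u - x)) (2 * u - x) (Ioo x 1) u := by
    intro u _
    have := (hasDerivAt_id u).mul ((hasDerivAt_id u).sub_const x)
    convert! this.hasDerivWithinAt using 1
    simp only [id]
    ring
  rw [← image_mul_sub_Ioo hx0,
    integral_image_eq_integral_abs_deriv_smul measurableSet_Ioo hder hinj, hFun, abs_of_nonneg hx0,
    if_pos hx1, intervalIntegral.integral_of_le hx1.le, integral_Ioc_eq_integral_Ioo]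
  refine setIntegral_congr_fun measurableSet_Ioo fun u hu => ?_
  have h1 : 0 ≤ u := hx0.trans hu.1.le
  have h2 : 0 ≤ u - x := by linarith [hu.1]
  have h3 : 0 ≤ 1 - u ^ 2 := by nlinarith [hu.2]
  have h4 : 0 ≤ 1 - (u - x) ^ 2 := by nlinarith [hu.2]
  simp only [gFun, smul_eq_mul]
  rw [abs_of_nonneg (by linarith : 0 ≤ 2 * u - x), Real.mul_rpow h1 h2,
    show (1 - u * (u - x)) ^ 2 - x ^ 2 = (1 - u ^ 2) * (1 - (u - x) ^ 2) by ring,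
    Real.mul_rpow h3 h4]
  ring

/-- After scaling to the unit interval, all singularities in the integral for `hFun` at fixed
`ν > 1/2` are dominated uniformly in `x`. -/
theorem hFun_eq_rpow_mul (μ ν : ℝ) (hμν : 1 < μ + ν) {x : ℝ} (hx : x ∈ Icc (0 : ℝ) 1) :
    hFun μ ν x = (1 - x) ^ (μ + ν - 1) *
      ∫ w in Ioo (0 : ℝ) 1, w ^ (μ - 1) * (1 - w) ^ (ν - 1) *
        (2 * x + (1 - x) * (1 - w)) ^ (ν - 1) := by
  rcases hx.2.eq_or_lt with rfl | hx1
  · rw [hFun_of_one_le _ _ (by simp), sub_self, Real.zero_rpow (by linarith), zero_mul]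
  have hx0 := hx.1
  have hc : 0 < 1 - x := by linarith
  have hsub := intervalIntegral.integral_comp_mul_left (a := 0) (b := 1)
    (fun p : ℝ => p ^ (μ - 1) * ((1 - p) ^ 2 - x ^ 2) ^ (ν - 1)) hc.ne'
  rw [mul_zero, mul_one, intervalIntegral.integral_of_le zero_le_one,
    intervalIntegral.integral_of_le hc.le, integral_Ioc_eq_integral_Ioo,
    integral_Ioc_eq_integral_Ioo, ← hFun_eq_setIntegral μ ν hx0 hx1, smul_eq_mul,
    eq_inv_mul_iff_mul_eq₀ hc.ne', ← integral_const_mul] at hsub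
  rw [← hsub, ← integral_const_mul]
  refine setIntegral_congr_fun measurableSet_Ioo fun w hw => ?_
  have hw1 : 0 ≤ 1 - w := by linarith [hw.2]
  have h1 : 0 ≤ 2 * x + (1 - x) * (1 - w) := by positivity
  rw [show (1 - (1 - x) * w) ^ 2 - x ^ 2 =
      (1 - x) * ((1 - w) * (2 * x + (1 - x) * (1 - w))) by ring,
    Real.mul_rpow hc.le hw.1.le, Real.mul_rpow hc.le (by positivity), Real.mul_rpow hw1 h1,
    show μ + ν - 1 = 1 + (μ - 1) + (ν - 1) by ring, Real.rpow_add hc, Real.rpow_add hc,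
    Real.rpow_one]
  ring

theorem continuous_hFun {μ ν : ℝ} (hμ : 0 < μ) (hν : 1 / 2 < ν) (hμν : 1 < μ + ν) :
    Continuous (hFun μ ν) := by
  have h01 : ContinuousOn (hFun μ ν) (Icc 0 1) := by
    refine ContinuousOn.congr (ContinuousOn.mul ?_ ?_) fun x hx => hFun_eq_rpow_mul μ ν hμν hx
    · exact ContinuousOn.rpow_const (by fun_prop) fun x _ => Or.inr (by linarith)
    · refine continuousOn_of_dominated (bound := fun w : ℝ =>
        w ^ (μ - 1) * (1 - w) ^ (2 * ν - 1 - 1) +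
          w ^ (μ - 1) * (1 - w) ^ (ν - 1) * 2 ^ (ν - 1)) ?_ ?_ ?_ ?_
      · intro x _
        exact Measurable.aestronglyMeasurable (by fun_prop)
      · intro x hx
        refine (ae_restrict_iff' measurableSet_Ioo).2 (Eventually.of_forall fun w hw => ?_)
        have hw1 : 0 < 1 - w := by linarith [hw.2]
        have h0 := hx.1
        have h1 : 1 - w ≤ 2 * x + (1 - x) * (1 - w) := by nlinarith [hw.1]
        have h2 : 2 * x + (1 - x) * (1 - w) ≤ 2 := by nlinarith [hw.1, hx.2]
        have h3 : 0 ≤ w ^ (μ - 1) * (1 - w) ^ (ν - 1) :=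
          mul_nonneg (Real.rpow_nonneg hw.1.le _) (Real.rpow_nonneg hw1.le _)
        have h4 : (1 - w) ^ (2 * ν - 1 - 1) = (1 - w) ^ (ν - 1) * (1 - w) ^ (ν - 1) := by
          rw [← Real.rpow_add hw1]
          ring_nf
        rw [Real.norm_of_nonneg (mul_nonneg h3 (Real.rpow_nonneg (hw1.le.trans h1) _)), h4,
          ← mul_assoc, ← mul_add]
        refine mul_le_mul_of_nonneg_left ?_ h3
        rcases le_total ν 1 with h | h
        · have := Real.rpow_le_rpow_of_nonpos hw1 h1 (by linarith : ν - 1 ≤ 0)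
          have h5 : (0 : ℝ) ≤ 2 ^ (ν - 1) := by positivity
          linarith
        · have := Real.rpow_le_rpow (hw1.le.trans h1) h2 (by linarith : 0 ≤ ν - 1)
          have h5 : (0 : ℝ) ≤ (1 - w) ^ (ν - 1) := by positivity
          linarith
      · exact (integrableOn_rpow_mul_one_sub_rpow hμ (by linarith)).add
          ((integrableOn_rpow_mul_one_sub_rpow hμ (by linarith)).mul_const _)
      · refine (ae_restrict_iff' measurableSet_Ioo).2 (Eventually.of_forall fun w hw => ?_)
        refine ContinuousOn.mul continuousOn_const (ContinuousOn.rpow_const (by fun_prop) ?_)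
        intro x hx
        left
        have := hx.1
        nlinarith [hw.1, hw.2]
  have h1 : ContinuousOn (hFun μ ν) (Ici 1) :=
    (continuousOn_const (c := (0 : ℝ))).congr fun x hx =>
      hFun_of_one_le _ _ ((mem_Ici.1 hx).trans (le_abs_self x))
  have h2 : ContinuousOn (hFun μ ν) (Ici 0) := by
    rw [← Icc_union_Ici_eq_Ici (zero_le_one' ℝ)]
    exact h01.union_of_isClosed h1 isClosed_Icc isClosed_Ici
  have h3 : Continuous fun x => hFun μ ν |x| :=
    h2.comp_continuous continuous_abs fun x => abs_nonneg x
  simpa only [hFun_abs] using h3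

/-- The profile `(1 - r²)^(κ-1)` of the Bochner-Riesz kernel, extended by `0` to `|r| ≥ 1`. -/
noncomputable def ballKernel (κ r : ℝ) : ℝ :=
  if |r| < 1 then (1 - r ^ 2) ^ (κ - 1) else 0

theorem ballKernel_nonneg (κ r : ℝ) : 0 ≤ ballKernel κ r := by
  unfold ballKernel
  split_ifs with h
  · have : r ^ 2 < 1 := (sq_lt_one_iff_abs_lt_one r).2 h
    exact Real.rpow_nonneg (by linarith) _
  · rfl

theorem measurable_ballKernel (κ : ℝ) : Measurable (ballKernel κ) :=
  Measurable.ite (measurableSet_lt (by fun_prop) measurable_const) (by fun_prop) measurable_const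

/-- `hFun` is a superposition of dilated Bochner-Riesz kernels. -/
theorem hFun_eq_integral_ballKernel (μ ν : ℝ) {x : ℝ} (hx : 0 ≤ x) :
    hFun μ ν x =
      ∫ s in Ioo (0 : ℝ) 1, (1 - s) ^ (μ - 1) * s ^ (2 * ν - 2) * ballKernel ν (s⁻¹ * x) := by
  rcases le_or_gt 1 x with h1 | h1
  · rw [hFun_of_one_le _ _ (h1.trans (le_abs_self x))]
    refine (setIntegral_eq_zero_of_forall_eq_zero fun s hs => ?_).symm
    have : ¬ |s⁻¹ * x| < 1 := by
      rw [not_lt, abs_of_nonneg (mul_nonneg (inv_nonneg.2 hs.1.le) hx), inv_mul_eq_div,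
        le_div_iff₀ hs.1]
      linarith [hs.2]
    rw [ballKernel, if_neg this, mul_zero]
  have hsub := intervalIntegral.integral_comp_sub_left (a := x) (b := 1)
    (fun p : ℝ => p ^ (μ - 1) * ((1 - p) ^ 2 - x ^ 2) ^ (ν - 1)) 1
  rw [sub_self, intervalIntegral.integral_of_le h1.le,
    intervalIntegral.integral_of_le (by linarith), integral_Ioc_eq_integral_Ioo,
    integral_Ioc_eq_integral_Ioo, ← hFun_eq_setIntegral μ ν hx h1] at hsub
  rw [← hsub, ← integral_indicator measurableSet_Ioo, ← integral_indicator measurableSet_Ioo]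
  refine integral_congr_ae ?_
  filter_upwards [compl_mem_ae_iff.2 (measure_singleton x)] with s hsx
  by_cases hs : s ∈ Ioo (0 : ℝ) 1
  · rw [indicator_of_mem hs]
    have hiff : |s⁻¹ * x| < 1 ↔ x < s := by
      rw [abs_of_nonneg (mul_nonneg (inv_nonneg.2 hs.1.le) hx), inv_mul_eq_div, div_lt_one hs.1]
    by_cases hxs : x < s
    · rw [indicator_of_mem (show s ∈ Ioo x 1 from ⟨hxs, hs.2⟩), ballKernel, if_pos (hiff.2 hxs)]
      have h2 : s ^ (2 * ν - 2) = (s ^ 2) ^ (ν - 1) := by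
        rw [← Real.rpow_natCast, ← Real.rpow_mul hs.1.le]
        norm_num
        ring_nf
      have h3 : (s⁻¹ * x) ^ 2 < 1 := (sq_lt_one_iff_abs_lt_one _).2 (hiff.2 hxs)
      have hs0 := hs.1.ne'
      rw [h2, mul_assoc, ← Real.mul_rpow (by positivity) (by linarith),
        show s ^ 2 * (1 - (s⁻¹ * x) ^ 2) = (1 - (1 - s)) ^ 2 - x ^ 2 by field_simp; ring]
    · rw [indicator_of_notMem (fun h => hxs h.1), ballKernel, if_neg (fun h => hxs (hiff.1 h)),
        mul_zero]
  · rw [indicator_of_notMem hs, indicator_of_notMem (fun h => hs ⟨hx.trans_lt h.1, h.2⟩)]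

/-! ### Fourier transforms of Bochner-Riesz kernels -/

/-- For an even real function the Fourier integral reduces to a cosine integral. -/
theorem integral_cexp_mul_even {w : ℝ → ℝ} (hw : Integrable w) (heven : ∀ y, w (-y) = w y)
    (t : ℝ) :
    ∫ y : ℝ, Complex.exp (((-(t * y) : ℝ) : ℂ) * Complex.I) * (w y : ℂ) =
      ((∫ y : ℝ, w y * Real.cos (t * y) : ℝ) : ℂ) := by
  have hre : ∀ y : ℝ, (Complex.exp (((-(t * y) : ℝ) : ℂ) * Complex.I) * (w y : ℂ)).re =
      w y * Real.cos (t * y) := by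
    intro y
    rw [Complex.re_mul_ofReal, Complex.exp_ofReal_mul_I_re, Real.cos_neg, mul_comm]
  have him : ∀ y : ℝ, (Complex.exp (((-(t * y) : ℝ) : ℂ) * Complex.I) * (w y : ℂ)).im =
      -(w y * Real.sin (t * y)) := by
    intro y
    rw [Complex.im_mul_ofReal, Complex.exp_ofReal_mul_I_im, Real.sin_neg, neg_mul, mul_comm]
  have hint : Integrable fun y : ℝ =>
      Complex.exp (((-(t * y) : ℝ) : ℂ) * Complex.I) * (w y : ℂ) := by
    refine hw.ofReal.bdd_mul (c := 1) ?_ ?_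
    · exact Continuous.aestronglyMeasurable (by fun_prop)
    · exact Eventually.of_forall fun y => (Complex.norm_exp_ofReal_mul_I _).le
  apply Complex.ext
  · rw [Complex.ofReal_re, ← Complex.reCLM_apply, ← Complex.reCLM.integral_comp_comm hint]
    exact integral_congr_ae (Eventually.of_forall hre)
  · rw [Complex.ofReal_im, ← Complex.imCLM_apply, ← Complex.imCLM.integral_comp_comm hint]
    have h1 : ∫ y : ℝ, -(w y * Real.sin (t * y)) = ∫ y : ℝ, w y * Real.sin (t * y) := by
      rw [← integral_neg_eq_self]
      refine integral_congr_ae (Eventually.of_forall fun y => ?_)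
      simp [heven]
    refine (integral_congr_ae (Eventually.of_forall him)).trans ?_
    rw [integral_neg] at h1 ⊢
    linarith

/-- A linear isometry from `ℝ × ℝ^k` onto `E` that maps the first axis to the line through `ξ`. -/
theorem exists_linearIsometryEquiv_prod {E : Type*} [NormedAddCommGroup E]
    [InnerProductSpace ℝ E] [FiniteDimensional ℝ E] {k : ℕ}
    (hk : Module.finrank ℝ E = k + 1) (ξ : E) :
    ∃ A : WithLp 2 (ℝ × EuclideanSpace ℝ (Fin k)) ≃ₗᵢ[ℝ] E, A (WithLp.toLp 2 (‖ξ‖, 0)) = ξ := by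
  have hfin : Module.finrank ℝ (WithLp 2 (ℝ × EuclideanSpace ℝ (Fin k))) =
      Module.finrank ℝ E := by
    rw [(WithLp.linearEquiv 2 ℝ (ℝ × EuclideanSpace ℝ (Fin k))).finrank_eq, Module.finrank_prod,
      Module.finrank_self, finrank_euclideanSpace_fin, hk, add_comm]
  let B := (stdOrthonormalBasis ℝ (WithLp 2 (ℝ × EuclideanSpace ℝ (Fin k)))).equiv
    (stdOrthonormalBasis ℝ E) (finCongr hfin)
  set u := B (WithLp.toLp 2 (‖ξ‖, 0)) with hu
  have hnorm : ‖u‖ = ‖ξ‖ := by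
    rw [hu, LinearIsometryEquiv.norm_map, WithLp.prod_norm_eq_of_L2]
    simp
  exact ⟨B.trans (Submodule.reflection (ℝ ∙ (u - ξ))ᗮ), Submodule.reflection_sub hnorm⟩

section BallKernel

variable {E : Type*} [NormedAddCommGroup E] [InnerProductSpace ℝ E] [FiniteDimensional ℝ E]
  [MeasurableSpace E] [BorelSpace E]

theorem integrable_ballKernel_norm {κ : ℝ} (hκ : 0 < κ) :
    Integrable fun x : E => ballKernel κ ‖x‖ := by
  rcases subsingleton_or_nontrivial E with hE | hE
  · have : (fun x : E => ballKernel κ ‖x‖) = fun _ => ballKernel κ 0 := by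
      ext x
      rw [Subsingleton.elim x 0, norm_zero]
    rw [this]
    exact integrable_const _
  · rw [integrable_fun_norm_addHaar]
    have h1 := integrableOn_mul_bounded (integrableOn_one_sub_sq_rpow hκ)
      (continuous_pow (Module.finrank ℝ E - 1))
    have h2 : IntegrableOn ((Ioo (-1 : ℝ) 1).indicator
        fun y : ℝ => (1 - y ^ 2) ^ (κ - 1) * y ^ (Module.finrank ℝ E - 1)) (Ioi 0) :=
      ((integrable_indicator_iff measurableSet_Ioo).2 h1).integrableOn
    refine h2.congr_fun (fun y _ => ?_) measurableSet_Ioi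
    by_cases hy : |y| < 1
    · have hy' : y ∈ Ioo (-1 : ℝ) 1 := abs_lt.1 hy
      simp only [indicator_of_mem hy', ballKernel, if_pos hy, smul_eq_mul]
      ring
    · have hy' : y ∉ Ioo (-1 : ℝ) 1 := fun h => hy (abs_lt.2 h)
      simp [indicator_of_notMem hy', ballKernel, if_neg hy]

theorem integral_ballKernel_norm_pos {κ : ℝ} (hκ : 0 < κ) :
    0 < ∫ x : E, ballKernel κ ‖x‖ := by
  rw [integral_pos_iff_support_of_nonneg (fun x => ballKernel_nonneg κ ‖x‖)
    (integrable_ballKernel_norm hκ)]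
  refine (Metric.measure_ball_pos volume (0 : E) one_pos).trans_le (measure_mono fun x hx => ?_)
  have h1 : ‖x‖ < 1 := by simpa using hx
  have h2 : ‖x‖ ^ 2 < 1 := by nlinarith [norm_nonneg x]
  rw [Function.mem_support, ballKernel, if_pos (by simpa using h1)]
  exact (Real.rpow_pos_of_pos (by linarith) _).ne'

/-- The integral of a Bochner-Riesz kernel on `ℝ × E` over the slice `{y} × E`. -/
theorem integral_ballKernel_sqrt (κ : ℝ) (y : ℝ) :
    ∫ z : E, ballKernel κ (√(y ^ 2 + ‖z‖ ^ 2)) =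
      (∫ z : E, ballKernel κ ‖z‖) * ballKernel (κ + Module.finrank ℝ E / 2) y := by
  have habs : ∀ z : E, |√(y ^ 2 + ‖z‖ ^ 2)| < 1 ↔ y ^ 2 + ‖z‖ ^ 2 < 1 := by
    intro z
    rw [abs_of_nonneg (Real.sqrt_nonneg _), Real.sqrt_lt' one_pos, one_pow]
  by_cases hy : |y| < 1
  · have hy2 : 0 < 1 - y ^ 2 := by linarith [(sq_lt_one_iff_abs_lt_one y).2 hy]
    set R : ℝ := √(1 - y ^ 2) with hR
    have hR0 : 0 < R := Real.sqrt_pos.2 hy2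
    have hR2 : R ^ 2 = 1 - y ^ 2 := Real.sq_sqrt hy2.le
    have hsec : ∀ z : E, ballKernel κ (√(y ^ 2 + ‖z‖ ^ 2)) =
        (1 - y ^ 2) ^ (κ - 1) * ballKernel κ ‖R⁻¹ • z‖ := by
      intro z
      have hn : ‖R⁻¹ • z‖ = R⁻¹ * ‖z‖ := by
        rw [norm_smul, Real.norm_of_nonneg (inv_nonneg.2 hR0.le)]
      have hn2 : ‖R⁻¹ • z‖ ^ 2 = ‖z‖ ^ 2 / (1 - y ^ 2) := by
        rw [hn, mul_pow, inv_pow, hR2, inv_mul_eq_div]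
      have hiff : |‖R⁻¹ • z‖| < 1 ↔ y ^ 2 + ‖z‖ ^ 2 < 1 := by
        rw [← sq_lt_one_iff_abs_lt_one, hn2, div_lt_one hy2]
        constructor <;> intro <;> linarith
      unfold ballKernel
      by_cases h : y ^ 2 + ‖z‖ ^ 2 < 1
      · rw [if_pos ((habs z).2 h), if_pos (hiff.2 h), Real.sq_sqrt (by positivity),
          ← Real.mul_rpow hy2.le, hn2]
        · congr 1
          field_simp
          ring
        · rw [hn2, sub_nonneg, div_le_one hy2]
          linarith
      · rw [if_neg (fun h' => h ((habs z).1 h')), if_neg (fun h' => h (hiff.1 h')), mul_zero]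
    simp_rw [hsec]
    rw [integral_const_mul, Measure.integral_comp_inv_smul_of_nonneg volume
      (fun z : E => ballKernel κ ‖z‖) hR0.le, smul_eq_mul, ballKernel, if_pos hy,
      add_sub_right_comm, Real.rpow_add hy2, div_eq_inv_mul, Real.rpow_mul hy2.le,
      Real.rpow_natCast, ← one_div, ← Real.sqrt_eq_rpow, ← hR]
    ring
  · rw [ballKernel, if_neg hy, mul_zero]
    refine integral_eq_zero_of_ae (Eventually.of_forall fun z => ?_)
    have : ¬ (y ^ 2 + ‖z‖ ^ 2 < 1) := by
      rw [← sq_lt_one_iff_abs_lt_one, not_lt] at hy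
      nlinarith [sq_nonneg ‖z‖]
    simp [ballKernel, habs, this]

theorem integral_cexp_mul_ballKernel {l : ℝ} (hl : 0 < l) (t : ℝ) :
    ∫ y : ℝ, Complex.exp (((-(t * y) : ℝ) : ℂ) * Complex.I) * (ballKernel l y : ℂ) =
      (besselKernel l t : ℂ) := by
  have heq : ballKernel l = (Ioo (-1 : ℝ) 1).indicator fun y => (1 - y ^ 2) ^ (l - 1) := by
    ext y
    by_cases hy : y ∈ Ioo (-1 : ℝ) 1
    · rw [indicator_of_mem hy, ballKernel, if_pos (abs_lt.2 hy)]
    · rw [indicator_of_notMem hy, ballKernel, if_neg (fun h => hy (abs_lt.1 h))]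
  have hint : Integrable (ballKernel l) := by
    rw [heq, integrable_indicator_iff measurableSet_Ioo]
    exact integrableOn_one_sub_sq_rpow hl
  rw [integral_cexp_mul_even hint (fun y => by simp [ballKernel]), besselKernel,
    ← integral_indicator measurableSet_Ioo, heq]
  congr 2
  ext y
  by_cases hy : y ∈ Ioo (-1 : ℝ) 1
  · simp only [indicator_of_mem hy]
  · simp only [indicator_of_notMem hy, zero_mul]

/-- The Fourier transform of a Bochner-Riesz kernel. Integrating over the hyperplanes orthogonal
to the frequency raises the exponent by half of their dimension. -/
theorem fourier_ballKernel_norm {k : ℕ} (hk : Module.finrank ℝ E = k + 1) {κ : ℝ} (hκ : 0 < κ)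
    (ξ : E) :
    𝓕 (fun x : E => (ballKernel κ ‖x‖ : ℂ)) ξ =
      (((∫ z : EuclideanSpace ℝ (Fin k), ballKernel κ ‖z‖) *
        besselKernel (κ + k / 2) (2 * Real.pi * ‖ξ‖) : ℝ) : ℂ) := by
  obtain ⟨A, hA⟩ := exists_linearIsometryEquiv_prod hk ξ
  have h1 := Real.fourier_comp_linearIsometry A (fun x : E => (ballKernel κ ‖x‖ : ℂ))
    (WithLp.toLp 2 (‖ξ‖, 0))
  rw [hA] at h1
  rw [← h1, Real.fourier_eq']
  simp only [Function.comp, LinearIsometryEquiv.norm_map, smul_eq_mul]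
  have hmp := WithLp.volume_preserving_toLp ℝ (EuclideanSpace ℝ (Fin k))
  have hemb : MeasurableEmbedding (@WithLp.toLp 2 (ℝ × EuclideanSpace ℝ (Fin k))) :=
    (MeasurableEquiv.toLp 2 (ℝ × EuclideanSpace ℝ (Fin k))).measurableEmbedding
  rw [← hmp.integral_comp hemb]
  have hint : Integrable fun p : ℝ × EuclideanSpace ℝ (Fin k) =>
      Complex.exp (((-2 * Real.pi * ⟪WithLp.toLp 2 p, WithLp.toLp 2 (‖ξ‖, 0)⟫ : ℝ) : ℂ) *
        Complex.I) * (ballKernel κ ‖WithLp.toLp 2 p‖ : ℂ) := by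
    refine (hmp.integrable_comp_emb hemb (g := fun v =>
      Complex.exp (((-2 * Real.pi * ⟪v, WithLp.toLp 2 (‖ξ‖, 0)⟫ : ℝ) : ℂ) *
        Complex.I) * (ballKernel κ ‖v‖ : ℂ))).2 ?_
    refine (integrable_ballKernel_norm hκ).ofReal.bdd_mul (c := 1) ?_ ?_
    · exact Continuous.aestronglyMeasurable (by fun_prop)
    · exact Eventually.of_forall fun y => (Complex.norm_exp_ofReal_mul_I _).le
  rw [Measure.volume_eq_prod, integral_prod _ hint]
  have hin : ∀ y : ℝ, (∫ z : EuclideanSpace ℝ (Fin k),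
      Complex.exp (((-2 * Real.pi * ⟪WithLp.toLp 2 (y, z), WithLp.toLp 2 (‖ξ‖, 0)⟫ : ℝ) : ℂ) *
        Complex.I) * (ballKernel κ ‖WithLp.toLp 2 (y, z)‖ : ℂ)) =
      (∫ z : EuclideanSpace ℝ (Fin k), ballKernel κ ‖z‖ : ℝ) *
      (Complex.exp (((-((2 * Real.pi * ‖ξ‖) * y) : ℝ) : ℂ) * Complex.I) *
        (ballKernel (κ + k / 2) y : ℂ)) := by
    intro y
    have h2 : ∀ z : EuclideanSpace ℝ (Fin k),
        -2 * Real.pi * ⟪WithLp.toLp 2 (y, z), WithLp.toLp 2 (‖ξ‖, 0)⟫ =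
          -((2 * Real.pi * ‖ξ‖) * y) := by
      intro z
      simp [WithLp.prod_inner_apply]
      ring
    have h3 : ∀ z : EuclideanSpace ℝ (Fin k), ‖WithLp.toLp 2 (y, z)‖ = √(y ^ 2 + ‖z‖ ^ 2) := by
      intro z
      simp [WithLp.prod_norm_eq_of_L2]
    simp_rw [h2, h3]
    rw [integral_const_mul, integral_complex_ofReal, integral_ballKernel_sqrt,
      finrank_euclideanSpace_fin]
    push_cast
    ring
  simp_rw [hin]
  rw [integral_const_mul, integral_cexp_mul_ballKernel (by positivity)]
  push_cast
  ring

theorem fourier_comp_inv_smul (f : E → ℂ) {s : ℝ} (hs : 0 < s) (ξ : E) :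
    𝓕 (fun x : E => f (s⁻¹ • x)) ξ = (s : ℂ) ^ Module.finrank ℝ E * 𝓕 f (s • ξ) := by
  rw [Real.fourier_eq', Real.fourier_eq']
  have := Measure.integral_comp_inv_smul_of_nonneg volume (fun x : E =>
    Complex.exp (((-2 * Real.pi * ⟪x, s • ξ⟫ : ℝ) : ℂ) * Complex.I) • f x) hs.le
  simp_rw [real_inner_smul_left, real_inner_smul_right, inv_mul_cancel_left₀ hs.ne'] at this
  rw [this, Complex.real_smul]
  simp_rw [real_inner_smul_right]
  push_cast
  rfl

end BallKernel

/-! ### The Fourier transform of `hFun` and its Laplace transform -/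

/-- The function of `2 π ‖ξ‖` to which the Fourier transform of `x ↦ hFun μ ν ‖x‖` on `ℝ^m` is
proportional, where `l = ν + (m - 1) / 2`. -/
noncomputable def radialTransform (μ l t : ℝ) : ℝ :=
  ∫ s in Ioo (0 : ℝ) 1, (1 - s) ^ (μ - 1) * s ^ (2 * l - 1) * besselKernel l (s * t)

theorem integrableOn_one_sub_rpow_mul_rpow {a b : ℝ} (ha : 0 < a) (hb : 0 < b) :
    IntegrableOn (fun s : ℝ => (1 - s) ^ (a - 1) * s ^ (b - 1)) (Ioo 0 1) :=
  (integrableOn_rpow_mul_one_sub_rpow hb ha).congr_fun (fun _ _ => mul_comm _ _) measurableSet_Ioo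

theorem norm_radialTransform_integrand_le (μ : ℝ) {l : ℝ} (hl : 0 < l) (t : ℝ) :
    ∀ᵐ s ∂volume.restrict (Ioo (0 : ℝ) 1),
    ‖(1 - s) ^ (μ - 1) * s ^ (2 * l - 1) * besselKernel l (s * t)‖ ≤
      (1 - s) ^ (μ - 1) * s ^ (2 * l - 1) * besselKernel l 0 := by
  refine (ae_restrict_iff' measurableSet_Ioo).2 (Eventually.of_forall fun s hs => ?_)
  have h1 : 0 ≤ (1 - s) ^ (μ - 1) * s ^ (2 * l - 1) :=
    mul_nonneg (Real.rpow_nonneg (by linarith [hs.2]) _) (Real.rpow_nonneg hs.1.le _)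
  rw [norm_mul, Real.norm_of_nonneg h1]
  exact mul_le_mul_of_nonneg_left (abs_besselKernel_le hl _) h1

section RadialTransform

variable {μ l : ℝ} (hμ : 0 < μ) (hl : 0 < l)
include hμ hl

theorem integrableOn_radialTransform_bound :
    IntegrableOn (fun s : ℝ => (1 - s) ^ (μ - 1) * s ^ (2 * l - 1) * besselKernel l 0)
      (Ioo 0 1) :=
  (integrableOn_one_sub_rpow_mul_rpow hμ (by positivity)).mul_const _

theorem continuous_radialTransform : Continuous (radialTransform μ l) := by
  have hc := continuous_besselKernel hl
  refine continuous_of_dominated (fun t => ?_) (norm_radialTransform_integrand_le μ hl)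
    (integrableOn_radialTransform_bound hμ hl) (Eventually.of_forall fun s => by fun_prop)
  exact AEStronglyMeasurable.mul (Measurable.aestronglyMeasurable (by fun_prop))
    (by fun_prop : Continuous fun s => besselKernel l (s * t)).aestronglyMeasurable

theorem exists_abs_radialTransform_le : ∃ M, ∀ t, |radialTransform μ l t| ≤ M :=
  ⟨_, fun t => norm_integral_le_of_norm_le (integrableOn_radialTransform_bound hμ hl)
    (norm_radialTransform_integrand_le μ hl t)⟩

/-- After the factor `t^(μ+2l-1)`, the radial transform becomes the convolution of `v^(2l-1) Ψ(v)`,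
with `Ψ` the Bessel kernel, and `v^(μ-1)`, so that its Laplace transform factors. -/
theorem weightedLaplace_radialTransform {p : ℝ} (hp : 0 < p) :
    weightedLaplace (μ + 2 * l - 1) (radialTransform μ l) p =
      Real.Gamma μ / p ^ μ * weightedLaplace (2 * l - 1) (besselKernel l) p := by
  have h1 := integral_posConvolution (μ := volume) (ν := volume)
    (integrableOn_weightedLaplace (σ := 2 * l - 1) (by linarith) hp (continuous_besselKernel hl)
      (abs_besselKernel_le hl))
    (integrableOn_rpow_mul_exp (σ := μ - 1) (by linarith) hp) (ContinuousLinearMap.mul ℝ ℝ)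
  simp only [ContinuousLinearMap.mul_apply'] at h1
  rw [integral_rpow_mul_exp (by linarith) hp, sub_add_cancel] at h1
  rw [weightedLaplace, weightedLaplace, mul_comm (Real.Gamma μ / p ^ μ), ← h1]
  refine setIntegral_congr_fun measurableSet_Ioi fun x hx => ?_
  rw [mem_Ioi] at hx
  have hsub := intervalIntegral.integral_comp_mul_right (a := 0) (b := 1)
    (fun t : ℝ => t ^ (2 * l - 1) * Real.exp (-(p * t)) * besselKernel l t *
      ((x - t) ^ (μ - 1) * Real.exp (-(p * (x - t))))) hx.ne'
  rw [zero_mul, one_mul, smul_eq_mul, eq_inv_mul_iff_mul_eq₀ hx.ne'] at hsub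
  rw [← hsub, intervalIntegral.integral_of_le zero_le_one, integral_Ioc_eq_integral_Ioo,
    radialTransform, ← integral_const_mul, ← integral_const_mul]
  refine setIntegral_congr_fun measurableSet_Ioo fun s hs => ?_
  have hexp : Real.exp (-(p * (s * x))) * Real.exp (-(p * (x - s * x))) = Real.exp (-(p * x)) := by
    rw [← Real.exp_add]
    ring_nf
  rw [show x - s * x = (1 - s) * x by ring] at hexp ⊢
  rw [Real.mul_rpow hs.1.le hx.le, Real.mul_rpow (by linarith [hs.2]) hx.le,
    show μ + 2 * l - 1 = 1 + (2 * l - 1) + (μ - 1) by ring, Real.rpow_add hx, Real.rpow_add hx,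
    Real.rpow_one, ← hexp]
  ring

end RadialTransform

/-- The kernel dilated by `s` contributes `s^(2ν-2) s^(k+1) = s^(2l-1)` to the weight in the radial
transform, with `l = ν + k / 2`. -/
theorem fourier_hFun_norm {E : Type*} [NormedAddCommGroup E] [InnerProductSpace ℝ E]
    [FiniteDimensional ℝ E] [MeasurableSpace E] [BorelSpace E] {k : ℕ}
    (hk : Module.finrank ℝ E = k + 1) {μ ν : ℝ} (hμ : 0 < μ) (hν : 1 / 2 < ν) (ξ : E) :
    𝓕 (fun x : E => (hFun μ ν ‖x‖ : ℂ)) ξ =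
      (((∫ z : EuclideanSpace ℝ (Fin k), ballKernel ν ‖z‖) *
        radialTransform μ (ν + k / 2) (2 * Real.pi * ‖ξ‖) : ℝ) : ℂ) := by
  have hν0 : 0 < ν := by linarith
  set K : ℝ → ℝ := fun s => (1 - s) ^ (μ - 1) * s ^ (2 * ν - 2) with hK
  have hK0 : ∀ s ∈ Ioo (0 : ℝ) 1, 0 ≤ K s := fun s hs =>
    mul_nonneg (Real.rpow_nonneg (by linarith [hs.2]) _) (Real.rpow_nonneg hs.1.le _)
  have hnorm : ∀ s ∈ Ioo (0 : ℝ) 1, ∀ x : E, s⁻¹ * ‖x‖ = ‖s⁻¹ • x‖ := fun s hs x => by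
    rw [norm_smul, Real.norm_of_nonneg (inv_nonneg.2 hs.1.le)]
  have hpow : ∀ s ∈ Ioo (0 : ℝ) 1, K s * s ^ (k + 1) =
      (1 - s) ^ (μ - 1) * s ^ (2 * (ν + k / 2) - 1) := fun s hs => by
    rw [hK, mul_assoc, ← Real.rpow_natCast, ← Real.rpow_add hs.1]
    push_cast
    ring_nf
  set e : E → ℂ := fun x => Complex.exp (((-2 * Real.pi * ⟪x, ξ⟫ : ℝ) : ℂ) * Complex.I) with he
  have hec : Continuous e := by fun_prop
  have hen : ∀ x, ‖e x‖ = 1 := fun x => Complex.norm_exp_ofReal_mul_I _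
  have hmeas : Measurable fun q : E × ℝ =>
      e q.1 * ((K q.2 * ballKernel ν (q.2⁻¹ * ‖q.1‖) : ℝ) : ℂ) := by
    have := measurable_ballKernel ν
    have := hec.measurable
    fun_prop
  have hsect : ∀ s ∈ Ioo (0 : ℝ) 1, Integrable fun x : E => ballKernel ν (s⁻¹ * ‖x‖) := by
    intro s hs
    simp_rw [hnorm s hs]
    exact (integrable_ballKernel_norm hν0).comp_smul (inv_ne_zero hs.1.ne')
  have hprod : Integrable (fun q : E × ℝ =>
      e q.1 * ((K q.2 * ballKernel ν (q.2⁻¹ * ‖q.1‖) : ℝ) : ℂ))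
      (volume.prod (volume.restrict (Ioo (0 : ℝ) 1))) := by
    rw [integrable_prod_iff' hmeas.aestronglyMeasurable]
    constructor
    · refine (ae_restrict_iff' measurableSet_Ioo).2 (Eventually.of_forall fun s hs => ?_)
      refine (((hsect s hs).const_mul (K s)).ofReal).bdd_mul (c := 1) hec.aestronglyMeasurable ?_
      exact Eventually.of_forall fun x => (hen x).le
    · have h1 := (integrableOn_one_sub_rpow_mul_rpow (a := μ) (b := 2 * (ν + k / 2)) hμ
        (by positivity)).mul_const (∫ x : E, ballKernel ν ‖x‖)
      refine IntegrableOn.congr_fun h1 (fun s hs => ?_) measurableSet_Ioo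
      have h2 : ∀ x : E, ‖e x * ((K s * ballKernel ν (s⁻¹ * ‖x‖) : ℝ) : ℂ)‖ =
          K s * ballKernel ν ‖s⁻¹ • x‖ := fun x => by
        rw [norm_mul, hen, one_mul, Complex.norm_real, hnorm s hs,
          Real.norm_of_nonneg (mul_nonneg (hK0 s hs) (ballKernel_nonneg _ _))]
      simp_rw [h2]
      rw [integral_const_mul, Measure.integral_comp_inv_smul_of_nonneg volume
        (fun x : E => ballKernel ν ‖x‖) hs.1.le, hk, smul_eq_mul, ← mul_assoc, hpow s hs]
  rw [Real.fourier_eq']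
  have h1 : ∀ x : E, e x • (hFun μ ν ‖x‖ : ℂ) =
      ∫ s in Ioo (0 : ℝ) 1, e x * ((K s * ballKernel ν (s⁻¹ * ‖x‖) : ℝ) : ℂ) := by
    intro x
    rw [hFun_eq_integral_ballKernel μ ν (norm_nonneg x), smul_eq_mul, integral_const_mul,
      integral_complex_ofReal]
  change ∫ x, e x • (hFun μ ν ‖x‖ : ℂ) = _
  simp_rw [h1]
  rw [integral_integral_swap hprod, radialTransform, ← integral_const_mul,
    ← integral_complex_ofReal]
  refine setIntegral_congr_fun measurableSet_Ioo fun s hs => ?_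
  have h2 := fourier_comp_inv_smul (fun x : E => (ballKernel ν ‖x‖ : ℂ)) hs.1 ξ
  rw [fourier_ballKernel_norm hk hν0, Real.fourier_eq', hk, norm_smul,
    Real.norm_of_nonneg hs.1.le] at h2
  have h3 : ∀ x : E, e x * ((K s * ballKernel ν (s⁻¹ * ‖x‖) : ℝ) : ℂ) =
      (K s : ℂ) * (e x • (ballKernel ν ‖s⁻¹ • x‖ : ℂ)) := fun x => by
    rw [hnorm s hs, smul_eq_mul]
    push_cast
    ring
  simp only [h3]
  rw [integral_const_mul, h2, ← hpow s hs]
  push_cast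
  ring_nf

/-! ### Positive definiteness and the Fourier transform -/

/-- A bounded kernel all of whose finite sums `∑ i, ∑ j, q (x i, x j)` are nonnegative has a
nonnegative double integral against `P ⊗ P`: take the expectation of the sum over `n` independent
points with law `P`. The diagonal contributes only `n` of the `n ^ 2` terms. -/
theorem integral_prod_nonneg_of_sum_nonneg {X : Type*} [MeasurableSpace X] (P : Measure X)
    [IsProbabilityMeasure P] {q : X × X → ℝ} (hq : Measurable q) {B : ℝ} (hB : ∀ x, |q x| ≤ B)
    (hsum : ∀ (n : ℕ) (x : Fin n → X), 0 ≤ ∑ i, ∑ j, q (x i, x j)) :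
    0 ≤ ∫ x, q x ∂P.prod P := by
  set J := ∫ x, q x ∂P.prod P with hJ
  set A := ∫ x, q (x, x) ∂P with hA
  have hint : ∀ (n : ℕ) (i j : Fin n),
      Integrable (fun z : Fin n → X => q (z i, z j)) (Measure.pi fun _ => P) := fun n i j =>
    Integrable.of_bound (Measurable.aestronglyMeasurable (by fun_prop)) B
      (Eventually.of_forall fun z => hB _)
  have hdiag : ∀ (n : ℕ) (i : Fin n),
      ∫ z : Fin n → X, q (z i, z i) ∂(Measure.pi fun _ => P) = A := by
    intro n i
    have h1 := measurePreserving_eval (fun _ : Fin n => P) i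
    have h2 := integral_map (φ := Function.eval i) (μ := Measure.pi fun _ : Fin n => P)
      (f := fun x => q (x, x)) h1.measurable.aemeasurable
      (Measurable.aestronglyMeasurable (by fun_prop))
    rw [h1.map_eq] at h2
    exact h2.symm
  have hoff : ∀ (n : ℕ) (i j : Fin n), i ≠ j →
      ∫ z : Fin n → X, q (z i, z j) ∂(Measure.pi fun _ => P) = J := by
    intro n i j hij
    have h1 := (ProbabilityTheory.iIndepFun_pi (μ := fun _ : Fin n => P) (X := fun _ => id)
      fun _ => aemeasurable_id).indepFun hij
    simp only [id] at h1
    rw [ProbabilityTheory.indepFun_iff_map_prod_eq_prod_map_map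
      (measurable_pi_apply i).aemeasurable (measurable_pi_apply j).aemeasurable] at h1
    have h2 : ∀ i : Fin n, Measure.map (fun z : Fin n → X => z i) (Measure.pi fun _ => P) = P :=
      fun i => (measurePreserving_eval (fun _ : Fin n => P) i).map_eq
    rw [h2, h2] at h1
    rw [hJ, ← h1, integral_map
      ((measurable_pi_apply i).prodMk (measurable_pi_apply j)).aemeasurable hq.aestronglyMeasurable]
  have hexp : ∀ n : ℕ, 0 ≤ n * A + (n * n - n) * J := by
    intro n
    have h1 : 0 ≤ ∫ z : Fin n → X, ∑ i, ∑ j, q (z i, z j) ∂(Measure.pi fun _ => P) :=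
      integral_nonneg fun z => hsum n z
    rw [integral_finsetSum _ fun i _ => integrable_finsetSum _ fun j _ => hint n i j] at h1
    simp_rw [integral_finsetSum _ fun j (_ : j ∈ Finset.univ) => hint n _ j] at h1
    have h2 : ∀ i j : Fin n, ∫ z : Fin n → X, q (z i, z j) ∂(Measure.pi fun _ => P) =
        J + if i = j then A - J else 0 := by
      intro i j
      split_ifs with h
      · rw [h, hdiag]; ring
      · rw [hoff n i j h]; ring
    simp_rw [h2] at h1
    simp only [Finset.sum_add_distrib, Finset.sum_ite_eq, Finset.mem_univ, if_true,
      Finset.sum_const, Finset.card_univ, Fintype.card_fin, nsmul_eq_mul] at h1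
    linarith
  by_contra! hneg
  obtain ⟨n, hn⟩ := exists_nat_gt (A / -J + 1)
  have h1 : A < (n - 1) * -J := by
    rw [← div_lt_iff₀ (by linarith)]
    linarith
  have hn0 : (0 : ℝ) < n := by
    rcases Nat.eq_zero_or_pos n with h | h
    · subst h
      have h2 := hexp 1
      have : 0 ≤ A / -J := div_nonneg (by simpa using h2) (by linarith)
      norm_num at hn
      linarith
    · exact_mod_cast h
  have h2 := hexp n
  nlinarith

section Bochner

variable {E : Type*} [NormedAddCommGroup E] [InnerProductSpace ℝ E] [FiniteDimensional ℝ E]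
  [MeasurableSpace E] [BorelSpace E]

theorem integrable_exp_neg_mul_sq_norm {b : ℝ} (hb : 0 < b) :
    Integrable fun x : E => Real.exp (-b * ‖x‖ ^ 2) := by
  have := (GaussianFourier.integrable_cexp_neg_mul_sq_norm_add (V := E) (b := (b : ℂ))
    (by simpa) 0 0).norm
  refine this.congr (Eventually.of_forall fun x => ?_)
  simp only [zero_mul, add_zero]
  rw [Complex.norm_exp]
  congr 1
  norm_cast

/-- A Gaussian average of a function all of whose sums `∑ i, ∑ j, G (x i - x j)` are nonnegative:
the difference of two independent Gaussian vectors is again Gaussian. -/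
theorem integral_mul_gaussian_nonneg {G : E → ℝ} (hG : Continuous G) (hGi : Integrable G)
    {B : ℝ} (hB : ∀ x, |G x| ≤ B)
    (hsum : ∀ (n : ℕ) (x : Fin n → E), 0 ≤ ∑ i, ∑ j, G (x i - x j)) {b : ℝ} (hb : 0 < b) :
    0 ≤ ∫ z, Real.exp (-b * ‖z‖ ^ 2) * G z := by
  set ρ : E → ℝ := fun x => Real.exp (-(2 * b) * ‖x‖ ^ 2) with hρ
  have hρi : Integrable ρ := integrable_exp_neg_mul_sq_norm (by positivity)
  have hρc : Continuous ρ := by fun_prop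
  have hρ0 : ∀ x, 0 ≤ ρ x := fun x => (Real.exp_pos _).le
  have hρ1 : ∀ x, ρ x ≤ 1 := fun x => Real.exp_le_one_iff.2 (by nlinarith [sq_nonneg ‖x‖])
  set Z := ∫ x, ρ x with hZ
  have hZ0 : 0 < Z := integral_exp_pos hρi
  set P : Measure E := volume.withDensity fun x => ENNReal.ofReal (ρ x / Z) with hP
  have hPp : IsProbabilityMeasure P := by
    refine ⟨?_⟩
    rw [hP, withDensity_apply _ MeasurableSet.univ, Measure.restrict_univ,
      ← ofReal_integral_eq_lintegral_ofReal (hρi.div_const Z)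
        (Eventually.of_forall fun x => div_nonneg (hρ0 x) hZ0.le), integral_div, ← hZ,
      div_self hZ0.ne', ENNReal.ofReal_one]
  have hPint : ∀ f : E → ℝ, ∫ x, f x ∂P = Z⁻¹ * ∫ x, ρ x * f x := by
    intro f
    rw [hP, integral_withDensity_eq_integral_toReal_smul (by fun_prop)
      (Eventually.of_forall fun x => ENNReal.ofReal_lt_top), ← integral_const_mul]
    refine integral_congr_ae (Eventually.of_forall fun x => ?_)
    simp only [ENNReal.toReal_ofReal (div_nonneg (hρ0 x) hZ0.le), smul_eq_mul]
    ring
  have h1 := integral_prod_nonneg_of_sum_nonneg P (q := fun x : E × E => G (x.1 - x.2))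
    (by fun_prop) (fun x => hB _) hsum
  rw [integral_prod_symm _ (Integrable.of_bound (Continuous.aestronglyMeasurable (by fun_prop)) B
    (Eventually.of_forall fun x => hB _))] at h1
  simp_rw [hPint] at h1
  have h2 : ∀ y : E, ∫ x, ρ x * G (x - y) = ∫ z, ρ (z + y) * G z := by
    intro y
    rw [← integral_add_right_eq_self (fun x => ρ x * G (x - y)) y]
    simp
  simp_rw [h2, mul_left_comm _ Z⁻¹, integral_const_mul, ← integral_const_mul (ρ _)] at h1
  have h3 : Integrable (fun p : E × E => ρ p.1 * (ρ (p.2 + p.1) * G p.2))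
      (volume.prod volume) := by
    have := (hρi.mul_prod hGi).bdd_mul (c := 1) (f := fun p : E × E => ρ (p.2 + p.1))
      (Continuous.aestronglyMeasurable (by fun_prop))
      (Eventually.of_forall fun p => by
        rw [Real.norm_of_nonneg (hρ0 _)]
        exact hρ1 _)
    refine this.congr (Eventually.of_forall fun p => ?_)
    simp only
    ring
  rw [integral_integral_swap h3] at h1
  -- completing the square
  have h4 : ∀ z : E, ∫ y, ρ y * (ρ (z + y) * G z) =
      (∫ y : E, Real.exp (-(4 * b) * ‖y‖ ^ 2)) * (Real.exp (-b * ‖z‖ ^ 2) * G z) := by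
    intro z
    rw [← integral_add_right_eq_self (fun y : E => Real.exp (-(4 * b) * ‖y‖ ^ 2))
      ((1 / 2 : ℝ) • z), ← integral_mul_const]
    refine integral_congr_ae (Eventually.of_forall fun y => ?_)
    have h5 : -(2 * b) * ‖y‖ ^ 2 + -(2 * b) * ‖z + y‖ ^ 2 =
        -(4 * b) * ‖y + (1 / 2 : ℝ) • z‖ ^ 2 + -b * ‖z‖ ^ 2 := by
      rw [norm_add_sq_real, norm_add_sq_real, norm_smul, real_inner_smul_right,
        real_inner_comm y z, mul_pow]
      norm_num
      ring
    simp only [hρ]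
    rw [← mul_assoc, ← mul_assoc, ← Real.exp_add, ← Real.exp_add, h5]
  simp_rw [h4] at h1
  rw [integral_const_mul] at h1
  have h6 : 0 < ∫ y : E, Real.exp (-(4 * b) * ‖y‖ ^ 2) :=
    integral_exp_pos (integrable_exp_neg_mul_sq_norm (by positivity))
  have h7 := inv_pos.2 hZ0
  refine nonneg_of_mul_nonneg_right (nonneg_of_mul_nonneg_right ?_ h7) h6
  exact nonneg_of_mul_nonneg_right h1 h7

/-- The Fourier transform of a positive definite continuous integrable function is nonnegative. -/
theorem IsPositiveDefinite.fourier_re_nonneg {F : E → ℂ} (hF : IsPositiveDefinite F)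
    (hFc : Continuous F) (hFi : Integrable F) {B : ℝ} (hB : ∀ x, ‖F x‖ ≤ B) (ξ : E) :
    0 ≤ (𝓕 F ξ).re := by
  set e : E → ℂ := fun x => Complex.exp (((-2 * Real.pi * ⟪x, ξ⟫ : ℝ) : ℂ) * Complex.I) with he
  have hec : Continuous e := by fun_prop
  have hen : ∀ x, ‖e x‖ = 1 := fun x => Complex.norm_exp_ofReal_mul_I _
  have heF : Integrable fun x => e x * F x := hFi.bdd_mul (c := 1) hec.aestronglyMeasurable
    (Eventually.of_forall fun x => (hen x).le)
  set G : E → ℝ := fun x => (e x * F x).re with hG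
  have hGc : Continuous G := Complex.continuous_re.comp (hec.mul hFc)
  have hGi : Integrable G := heF.re
  have hGB : ∀ x, |G x| ≤ B := fun x => (Complex.abs_re_le_norm _).trans (by
    rw [norm_mul, hen, one_mul]
    exact hB x)
  have hsum : ∀ (n : ℕ) (x : Fin n → E), 0 ≤ ∑ i, ∑ j, G (x i - x j) := by
    intro n x
    have h1 := (hF n x fun i => e (x i)).1
    have h2 : ∀ i j, e (x i) * (starRingEnd ℂ) (e (x j)) * F (x i - x j) =
        e (x i - x j) * F (x i - x j) := by
      intro i j
      congr 1
      simp only [he]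
      rw [← Complex.exp_conj, ← Complex.exp_add, inner_sub_left]
      congr 1
      simp only [map_mul, Complex.conj_ofReal, Complex.conj_I]
      push_cast
      ring
    simp_rw [h2, Complex.re_sum] at h1
    exact h1
  have hpos := fun (b : ℝ) (hb : 0 < b) => integral_mul_gaussian_nonneg hGc hGi hGB hsum hb
  have hlim := Real.tendsto_integral_cexp_sq_smul heF
  rw [Real.fourier_eq']
  refine ge_of_tendsto ((Complex.continuous_re.tendsto _).comp hlim) ?_
  filter_upwards [Ioi_mem_atTop 0] with c (hc : 0 < c)
  have hre : ∀ v : E, (Complex.exp (-((c⁻¹ : ℝ) : ℂ) * (‖v‖ : ℂ) ^ 2) • (e v * F v)).re =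
      Real.exp (-c⁻¹ * ‖v‖ ^ 2) * G v := by
    intro v
    have : Complex.exp (-((c⁻¹ : ℝ) : ℂ) * (‖v‖ : ℂ) ^ 2) = (Real.exp (-c⁻¹ * ‖v‖ ^ 2) : ℂ) := by
      push_cast
      rfl
    rw [this, smul_eq_mul, Complex.re_ofReal_mul]
  have hi : Integrable fun v : E =>
      Complex.exp (-((c⁻¹ : ℝ) : ℂ) * (‖v‖ : ℂ) ^ 2) • (e v * F v) := by
    refine heF.bdd_mul (c := 1) (Continuous.aestronglyMeasurable (by fun_prop))
      (Eventually.of_forall fun v => ?_)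
    have : Complex.exp (-((c⁻¹ : ℝ) : ℂ) * (‖v‖ : ℂ) ^ 2) = (Real.exp (-c⁻¹ * ‖v‖ ^ 2) : ℂ) := by
      push_cast
      rfl
    rw [this, Complex.norm_real, Real.norm_of_nonneg (Real.exp_pos _).le, Real.exp_le_one_iff,
      neg_mul, neg_nonpos]
    positivity
  rw [Function.comp, ← Complex.reCLM_apply, ← Complex.reCLM.integral_comp_comm hi]
  simp only [Complex.reCLM_apply, hre]
  exact hpos c⁻¹ (inv_pos.2 hc)

/-- Fourier inversion with Gaussian summation at a point of continuity, without integrability of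
the Fourier transform. -/
theorem tendsto_integral_gaussian_mul_fourier {F : E → ℂ} (hFi : Integrable F) {v : E}
    (hFc : ContinuousAt F v) :
    Tendsto (fun c : ℝ => ∫ w : E,
      Complex.exp (-(c : ℂ)⁻¹ * ‖w‖ ^ 2 + 2 * Real.pi * Complex.I * ⟪v, w⟫) * 𝓕 F w)
      atTop (𝓝 (F v)) := by
  refine (Real.tendsto_integral_gaussian_smul' hFi hFc).congr' ?_
  filter_upwards [Ioi_mem_atTop 0] with c (hc : 0 < c)
  have J : Integrable (fun w : E =>
      Complex.exp (-(c : ℂ)⁻¹ * ‖w‖ ^ 2 + 2 * Real.pi * Complex.I * ⟪v, w⟫)) :=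
    GaussianFourier.integrable_cexp_neg_mul_sq_norm_add (by simpa) _ _
  have h := VectorFourier.integral_fourierIntegral_smul_eq_flip (L := innerₗ E)
      Real.continuous_fourierChar continuous_inner J hFi
  have h' : ∫ w : E, 𝓕 (fun w : E =>
      Complex.exp (-(c : ℂ)⁻¹ * ‖w‖ ^ 2 + 2 * Real.pi * Complex.I * ⟪v, w⟫)) w • F w =
      ∫ w : E, Complex.exp (-(c : ℂ)⁻¹ * ‖w‖ ^ 2 + 2 * Real.pi * Complex.I * ⟪v, w⟫) * 𝓕 F w := by
    simpa using! h
  rw [← h']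
  congr with w
  rw [fourier_gaussian_innerProductSpace' (by simpa), div_inv_eq_mul, div_inv_eq_mul,
    mul_right_comm (-(Real.pi : ℂ) ^ 2)]

/-- A continuous integrable function with nonnegative Fourier transform is positive definite. -/
theorem isPositiveDefinite_of_fourier_nonneg {F : E → ℂ} (hFc : Continuous F)
    (hFi : Integrable F) {r : E → ℝ} (hr : ∀ ξ, 𝓕 F ξ = (r ξ : ℂ)) (hr0 : ∀ ξ, 0 ≤ r ξ) :
    IsPositiveDefinite F := by
  intro n x a
  have hlim : Tendsto (fun c : ℝ => ∑ i, ∑ j, a i * (starRingEnd ℂ) (a j) * ∫ w : E,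
      Complex.exp (-(c : ℂ)⁻¹ * ‖w‖ ^ 2 + 2 * Real.pi * Complex.I * ⟪x i - x j, w⟫) * 𝓕 F w)
      atTop (𝓝 (∑ i, ∑ j, a i * (starRingEnd ℂ) (a j) * F (x i - x j))) :=
    tendsto_finsetSum _ fun i _ => tendsto_finsetSum _ fun j _ =>
      (tendsto_integral_gaussian_mul_fourier hFi hFc.continuousAt).const_mul _
  have hkey : ∀ᶠ c : ℝ in atTop, ∃ s : ℝ, 0 ≤ s ∧
      ∑ i, ∑ j, a i * (starRingEnd ℂ) (a j) * ∫ w : E,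
        Complex.exp (-(c : ℂ)⁻¹ * ‖w‖ ^ 2 + 2 * Real.pi * Complex.I * ⟪x i - x j, w⟫) * 𝓕 F w =
      (s : ℂ) := by
    filter_upwards [Ioi_mem_atTop 0] with c (hc : 0 < c)
    set T : E → ℂ := fun w => ∑ i, a i * Complex.exp (2 * Real.pi * Complex.I * ⟪x i, w⟫) with hT
    refine ⟨∫ w : E, Complex.normSq (T w) * (Real.exp (-c⁻¹ * ‖w‖ ^ 2) * r w),
      integral_nonneg fun w => mul_nonneg (Complex.normSq_nonneg _)
        (mul_nonneg (Real.exp_pos _).le (hr0 w)), ?_⟩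
    have hFTc : Continuous (𝓕 F) := VectorFourier.fourierIntegral_continuous
      Real.continuous_fourierChar continuous_inner hFi
    have hFTb : ∀ w, ‖𝓕 F w‖ ≤ ∫ x, ‖F x‖ := fun w =>
      VectorFourier.norm_fourierIntegral_le_integral_norm _ _ _ _ _
    have hi : ∀ u : E, Integrable fun w : E =>
        Complex.exp (-(c : ℂ)⁻¹ * ‖w‖ ^ 2 + 2 * Real.pi * Complex.I * ⟪u, w⟫) * 𝓕 F w := fun u =>
      (GaussianFourier.integrable_cexp_neg_mul_sq_norm_add (by simpa) _ _).mul_bdd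
        (c := ∫ x, ‖F x‖) hFTc.aestronglyMeasurable (Eventually.of_forall hFTb)
    simp_rw [← integral_const_mul]
    rw [← integral_complex_ofReal]
    simp_rw [← integral_finsetSum Finset.univ fun j _ => (hi (x _ - x j)).const_mul _]
    rw [← integral_finsetSum Finset.univ fun i _ => integrable_finsetSum Finset.univ
      fun j _ => (hi (x i - x j)).const_mul _]
    refine integral_congr_ae (Eventually.of_forall fun w => ?_)
    simp only [hr]
    push_cast
    rw [Complex.normSq_eq_conj_mul_self, mul_comm ((starRingEnd ℂ) (T w)), hT]
    simp only [map_sum, map_mul]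
    rw [Finset.sum_mul_sum, Finset.sum_mul]
    refine Finset.sum_congr rfl fun i _ => ?_
    rw [Finset.sum_mul]
    refine Finset.sum_congr rfl fun j _ => ?_
    have h1 : Complex.exp (-(c : ℂ)⁻¹ * ‖w‖ ^ 2 + 2 * Real.pi * Complex.I * ⟪x i - x j, w⟫) =
        Complex.exp (2 * Real.pi * Complex.I * ⟪x i, w⟫) *
          (starRingEnd ℂ) (Complex.exp (2 * Real.pi * Complex.I * ⟪x j, w⟫)) *
          Complex.exp (-(c : ℂ)⁻¹ * ‖w‖ ^ 2) := by
      rw [← Complex.exp_conj, ← Complex.exp_add, ← Complex.exp_add, inner_sub_left]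
      congr 1
      simp only [map_mul, Complex.conj_ofReal, Complex.conj_I, map_ofNat]
      push_cast
      ring
    rw [h1]
    ring
  constructor
  · refine ge_of_tendsto ((Complex.continuous_re.tendsto _).comp hlim) ?_
    filter_upwards [hkey] with c ⟨s, hs, h⟩
    rw [Function.comp, h]
    exact hs
  · refine tendsto_nhds_unique ((Complex.continuous_im.tendsto _).comp hlim)
      (tendsto_const_nhds.congr' ?_)
    filter_upwards [hkey] with c ⟨s, hs, h⟩
    rw [Function.comp, h, Complex.ofReal_im]

end Bochner

/-! ### The equivalence for `fFun` -/

theorem continuous_fFun {μ ν : ℝ} (ε β₁ β₂ : ℝ) (hμ : 0 < μ) (hν : 1 / 2 < ν)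
    (hμν : 1 < μ + ν) : Continuous (fFun μ ν ε β₁ β₂) := by
  have := continuous_hFun hμ hν hμν
  unfold fFun
  fun_prop

/-- The difference of dilated radial transforms whose sign decides both sides of the equivalence:
up to positive factors, its value at `β₂ (2 π ‖ξ‖)` is the Fourier transform of `fFun` at `ξ` in
`ℝ^(k+1)`, for `a = β₂ / β₁`, and its Laplace
transform with weight `t^(μ+2ν+k-1)` is the function required to be completely monotone. -/
noncomputable def radialDifference (μ ν ε a : ℝ) (k : ℕ) (t : ℝ) : ℝ :=
  radialTransform μ (ν + k / 2) t -
    a ^ (-ε - (k + 1)) * radialTransform μ (ν + k / 2) (a⁻¹ * t)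

section RadialDifference

variable {μ ν : ℝ} (hμ : 0 < μ) (hν : 1 / 2 < ν) (ε : ℝ) (k : ℕ)
include hμ hν

theorem continuous_radialDifference (a : ℝ) : Continuous (radialDifference μ ν ε a k) := by
  have hl : 0 < ν + k / 2 := by linarith [k.cast_nonneg (α := ℝ)]
  have := continuous_radialTransform hμ hl
  unfold radialDifference
  fun_prop

theorem exists_abs_radialDifference_le (a : ℝ) :
    ∃ M, ∀ t, |radialDifference μ ν ε a k t| ≤ M := by
  obtain ⟨M, hM⟩ := exists_abs_radialTransform_le hμ (l := ν + k / 2)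
    (by linarith [k.cast_nonneg (α := ℝ)])
  refine ⟨M + |a ^ (-ε - (k + 1))| * M, fun t => (abs_sub _ _).trans ?_⟩
  rw [abs_mul]
  have h1 := hM t
  have h2 := hM (a⁻¹ * t)
  gcongr

theorem exists_fourier_fFun_norm {E : Type*} [NormedAddCommGroup E] [InnerProductSpace ℝ E]
    [FiniteDimensional ℝ E] [MeasurableSpace E] [BorelSpace E]
    (hk : Module.finrank ℝ E = k + 1) (hμν : 1 < μ + ν) {β₁ β₂ : ℝ} (hβ₁ : 0 < β₁)
    (hβ₂ : 0 < β₂) :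
    ∃ C : ℝ, 0 < C ∧ ∀ ξ : E, 𝓕 (fun x : E => ((fFun μ ν ε β₁ β₂ ‖x‖ : ℝ) : ℂ)) ξ =
      ((C * radialDifference μ ν ε (β₂ / β₁) k (β₂ * (2 * Real.pi * ‖ξ‖)) : ℝ) : ℂ) := by
  set c := ∫ z : EuclideanSpace ℝ (Fin k), ballKernel ν ‖z‖ with hc
  have hc0 : 0 < c := integral_ballKernel_norm_pos (by linarith)
  refine ⟨c * (β₂ ^ ε * β₂ ^ (k + 1)), by positivity, fun ξ => ?_⟩
  have hdil : ∀ β : ℝ, 0 < β → 𝓕 (fun x : E => (hFun μ ν (‖x‖ / β) : ℂ)) ξ =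
      ((β ^ (k + 1) * (c * radialTransform μ (ν + k / 2) (β * (2 * Real.pi * ‖ξ‖))) : ℝ) : ℂ) := by
    intro β hβ
    have h1 := fourier_comp_inv_smul (fun x : E => (hFun μ ν ‖x‖ : ℂ)) hβ ξ
    have h2 : ∀ x : E, ‖β⁻¹ • x‖ = ‖x‖ / β := fun x => by
      rw [norm_smul, Real.norm_of_nonneg (inv_nonneg.2 hβ.le), inv_mul_eq_div]
    simp_rw [h2] at h1
    rw [h1, fourier_hFun_norm hk hμ hν, hk, norm_smul, Real.norm_of_nonneg hβ.le,
      mul_left_comm _ β]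
    push_cast
    rfl
  have hint : ∀ β : ℝ, 0 < β → Integrable fun x : E => (hFun μ ν (‖x‖ / β) : ℂ) := by
    intro β hβ
    have hcont := continuous_hFun hμ hν hμν
    refine Continuous.integrable_of_hasCompactSupport (by fun_prop) ?_
    refine HasCompactSupport.intro (isCompact_closedBall (0 : E) β) fun x hx => ?_
    rw [mem_closedBall_zero_iff, not_le] at hx
    rw [hFun_of_one_le, Complex.ofReal_zero]
    rw [abs_of_nonneg (by positivity), le_div_iff₀ hβ]
    linarith
  have hsplit : 𝓕 (fun x : E => ((fFun μ ν ε β₁ β₂ ‖x‖ : ℝ) : ℂ)) ξ =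
      (β₂ ^ ε : ℝ) * 𝓕 (fun x : E => (hFun μ ν (‖x‖ / β₂) : ℂ)) ξ -
        (β₁ ^ ε : ℝ) * 𝓕 (fun x : E => (hFun μ ν (‖x‖ / β₁) : ℂ)) ξ := by
    have hi : ∀ β : ℝ, 0 < β → Integrable fun x : E =>
        Complex.exp (((-2 * Real.pi * ⟪x, ξ⟫ : ℝ) : ℂ) * Complex.I) •
          (hFun μ ν (‖x‖ / β) : ℂ) := fun β hβ =>
      (hint β hβ).bdd_mul (c := 1) (Continuous.aestronglyMeasurable (by fun_prop))
        (Eventually.of_forall fun x => (Complex.norm_exp_ofReal_mul_I _).le)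
    rw [Real.fourier_eq', Real.fourier_eq', Real.fourier_eq', ← integral_const_mul,
      ← integral_const_mul, ← integral_sub ((hi β₂ hβ₂).const_mul _) ((hi β₁ hβ₁).const_mul _)]
    refine integral_congr_ae (Eventually.of_forall fun x => ?_)
    simp only [fFun, smul_eq_mul]
    push_cast
    ring
  rw [hsplit, hdil β₁ hβ₁, hdil β₂ hβ₂, ← Complex.ofReal_mul, ← Complex.ofReal_mul,
    ← Complex.ofReal_sub]
  congr 1
  have h3 : (β₂ / β₁)⁻¹ * (β₂ * (2 * Real.pi * ‖ξ‖)) = β₁ * (2 * Real.pi * ‖ξ‖) := by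
    field_simp
  have h4 : β₂ ^ ε * β₂ ^ (k + 1) * (β₂ / β₁) ^ (-ε - (k + 1)) = β₁ ^ ε * β₁ ^ (k + 1) := by
    rw [show -ε - ((k : ℝ) + 1) = -(ε + ((k + 1 : ℕ) : ℝ)) by push_cast; ring,
      Real.rpow_neg (by positivity), Real.div_rpow hβ₂.le hβ₁.le, Real.rpow_add hβ₂,
      Real.rpow_add hβ₁, Real.rpow_natCast, Real.rpow_natCast]
    field_simp
  rw [radialDifference, h3]
  linear_combination (c * radialTransform μ (ν + k / 2) (β₁ * (2 * Real.pi * ‖ξ‖))) * h4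

/-- As `ξ` varies, the argument `β₂ (2 π ‖ξ‖)` runs over `[0, ∞)`, so the sign of the Fourier
transform of `fFun` is that of `radialDifference`. -/
theorem fFun_mem_Phi_iff (hμν : 1 < μ + ν) {β₁ β₂ : ℝ} (hβ₁ : 0 < β₁) (hβ₂ : 0 < β₂) :
    fFun μ ν ε β₁ β₂ ∈ Phi (k + 1) ↔ ∀ t, 0 < t → 0 ≤ radialDifference μ ν ε (β₂ / β₁) k t := by
  have hf := continuous_fFun ε β₁ β₂ hμ hν hμν
  obtain ⟨C, hC, hFT⟩ := exists_fourier_fFun_norm (E := EuclideanSpace ℝ (Fin (k + 1))) hμ hν ε k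
    finrank_euclideanSpace_fin hμν hβ₁ hβ₂
  set F : EuclideanSpace ℝ (Fin (k + 1)) → ℂ := fun x => ((fFun μ ν ε β₁ β₂ ‖x‖ : ℝ) : ℂ) with hF
  have hFc : Continuous F := by fun_prop
  have hFs : HasCompactSupport F := by
    refine HasCompactSupport.intro (isCompact_closedBall 0 (max β₁ β₂)) fun x hx => ?_
    rw [mem_closedBall_zero_iff, not_le, max_lt_iff] at hx
    have h1 : ∀ β : ℝ, 0 < β → β < ‖x‖ → hFun μ ν (‖x‖ / β) = 0 := fun β hβ h =>
      hFun_of_one_le _ _ (by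
        rw [abs_of_nonneg (by positivity), le_div_iff₀ hβ]
        linarith)
    simp [hF, fFun, h1 β₁ hβ₁ hx.1, h1 β₂ hβ₂ hx.2]
  have hFi : Integrable F := hFc.integrable_of_hasCompactSupport hFs
  obtain ⟨B, hB⟩ := hFs.exists_bound_of_continuous hFc
  constructor
  · rintro ⟨-, hpd⟩ t ht
    have h1 := fun ξ => IsPositiveDefinite.fourier_re_nonneg hpd hFc hFi hB ξ
    obtain ⟨ξ, hξ⟩ := exists_norm_eq (EuclideanSpace ℝ (Fin (k + 1)))
      (show 0 ≤ t / (β₂ * (2 * Real.pi)) by positivity)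
    have h2 := h1 ξ
    rw [hFT, Complex.ofReal_re, hξ, ← mul_assoc, mul_div_cancel₀ _ (by positivity)] at h2
    exact nonneg_of_mul_nonneg_right h2 hC
  · intro h
    -- by continuity the sign condition extends to `t = 0`
    have h0 : ∀ t, 0 ≤ t → 0 ≤ radialDifference μ ν ε (β₂ / β₁) k t := by
      have hcl : IsClosed {t | 0 ≤ radialDifference μ ν ε (β₂ / β₁) k t} :=
        isClosed_le continuous_const (continuous_radialDifference hμ hν ε k _)
      have := hcl.closure_subset_iff.2 (fun t (ht : t ∈ Ioi (0 : ℝ)) => h t ht)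
      rw [closure_Ioi] at this
      exact fun t ht => this ht
    refine ⟨hf.continuousOn, isPositiveDefinite_of_fourier_nonneg hFc hFi hFT fun ξ => ?_⟩
    exact mul_nonneg hC.le (h0 _ (by positivity))

theorem exists_weightedLaplace_radialDifference {a : ℝ} (ha : 0 < a) :
    ∃ C : ℝ, 0 < C ∧ ∀ x, 0 < x →
      weightedLaplace (μ + 2 * (ν + k / 2) - 1) (radialDifference μ ν ε a k) x =
        C * (1 / (x ^ μ * (1 + x ^ 2) ^ ((k : ℝ) / 2 + ν)) -
          a ^ (2 * ν - 1 - ε) / (x ^ μ * (1 + a ^ 2 * x ^ 2) ^ ((k : ℝ) / 2 + ν))) := by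
  set l : ℝ := ν + k / 2 with hl
  have hl0 : 0 < l := by have : (0 : ℝ) ≤ k := k.cast_nonneg; linarith
  have hlc : (k : ℝ) / 2 + ν = l := add_comm _ _
  obtain ⟨C, hC, hCL⟩ := exists_weightedLaplace_besselKernel hl0
  refine ⟨Real.Gamma μ * C, mul_pos (Real.Gamma_pos_of_pos hμ) hC, fun x hx => ?_⟩
  obtain ⟨M, hM⟩ := exists_abs_radialTransform_le hμ hl0
  have hcont := continuous_radialTransform hμ hl0
  have hR : ∀ p, 0 < p → weightedLaplace (μ + 2 * l - 1) (radialTransform μ l) p =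
      Real.Gamma μ * C / (p ^ μ * (1 + p ^ 2) ^ l) := fun p hp => by
    rw [weightedLaplace_radialTransform hμ hl0 hp, hCL p hp, div_mul_div_comm]
  have hscale : weightedLaplace (μ + 2 * l - 1) (fun t => radialTransform μ l (a⁻¹ * t)) x =
      a ^ (2 * l) * (Real.Gamma μ * C / (x ^ μ * (1 + a ^ 2 * x ^ 2) ^ l)) := by
    have h1 := integral_comp_mul_left_Ioi (fun t : ℝ => t ^ (μ + 2 * l - 1) *
      Real.exp (-(x * t)) * radialTransform μ l (a⁻¹ * t)) 0 ha
    rw [mul_zero, smul_eq_mul, eq_inv_mul_iff_mul_eq₀ ha.ne'] at h1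
    rw [weightedLaplace, ← h1]
    have h2 : ∫ t in Ioi (0 : ℝ), (a * t) ^ (μ + 2 * l - 1) * Real.exp (-(x * (a * t))) *
        radialTransform μ l (a⁻¹ * (a * t)) =
        a ^ (μ + 2 * l - 1) * weightedLaplace (μ + 2 * l - 1) (radialTransform μ l) (a * x) := by
      rw [weightedLaplace, ← integral_const_mul]
      refine setIntegral_congr_fun measurableSet_Ioi fun t ht => ?_
      rw [mem_Ioi] at ht
      rw [Real.mul_rpow ha.le ht.le, inv_mul_cancel_left₀ ha.ne', mul_left_comm x, mul_assoc a]
      ring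
    rw [h2, hR _ (by positivity), Real.mul_rpow ha.le hx.le,
      show μ + 2 * l - 1 = μ + 2 * l + -1 by ring, Real.rpow_add ha, Real.rpow_add ha,
      Real.rpow_neg_one, mul_pow]
    field_simp
  have hsub : weightedLaplace (μ + 2 * l - 1) (radialDifference μ ν ε a k) x =
      weightedLaplace (μ + 2 * l - 1) (radialTransform μ l) x - a ^ (-ε - (k + 1)) *
        weightedLaplace (μ + 2 * l - 1) (fun t => radialTransform μ l (a⁻¹ * t)) x := by
    have i1 := integrableOn_weightedLaplace (σ := μ + 2 * l - 1) (by linarith) hx hcont hM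
    have i2 := integrableOn_weightedLaplace (σ := μ + 2 * l - 1)
      (D := fun t => radialTransform μ l (a⁻¹ * t)) (by linarith) hx (by fun_prop) fun t => hM _
    rw [weightedLaplace, weightedLaplace, weightedLaplace, ← integral_const_mul,
      ← integral_sub i1 (i2.const_mul _)]
    refine integral_congr_ae (Eventually.of_forall fun t => ?_)
    simp only [radialDifference, ← hl]
    ring
  have hexp : a ^ (2 * ν - 1 - ε) = a ^ (-ε - (k + 1)) * a ^ (2 * l) := by
    rw [← Real.rpow_add ha, hl]
    ring_nf
  rw [hsub, hR x hx, hscale, hlc, hexp]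
  ring

end RadialDifference

/-- As `x → 0+` the difference times `x ^ μ` tends to `1 - a ^ s`. -/
theorem nonpos_of_difference_nonneg {μ l a s : ℝ} (ha : 1 < a)
    (h : ∀ x : ℝ, 0 < x → 0 ≤ 1 / (x ^ μ * (1 + x ^ 2) ^ l) -
      a ^ s / (x ^ μ * (1 + a ^ 2 * x ^ 2) ^ l)) : s ≤ 0 := by
  have hle : ∀ x : ℝ, 0 < x → a ^ s * (1 + x ^ 2) ^ l ≤ (1 + a ^ 2 * x ^ 2) ^ l := by
    intro x hx
    have h1 := sub_nonneg.1 (h x hx)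
    rw [div_le_div_iff₀ (by positivity) (by positivity)] at h1
    have h2 : 0 < x ^ μ := Real.rpow_pos_of_pos hx _
    refine le_of_mul_le_mul_left ?_ h2
    linarith
  have hcont : ∀ b : ℝ, 0 ≤ b → Tendsto (fun x : ℝ => (1 + b * x ^ 2) ^ l) (𝓝[>] 0) (𝓝 1) := by
    intro b hb
    have : ContinuousAt (fun x : ℝ => (1 + b * x ^ 2) ^ l) 0 :=
      ContinuousAt.rpow_const (by fun_prop) (Or.inl (by norm_num))
    simpa using this.tendsto.mono_left (nhdsWithin_le_nhds (s := Ioi 0))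
  have hlim := le_of_tendsto_of_tendsto ((hcont 1 zero_le_one).const_mul (a ^ s))
    (hcont (a ^ 2) (sq_nonneg a)) (by
      filter_upwards [self_mem_nhdsWithin] with x hx
      simpa using hle x hx)
  rw [mul_one] at hlim
  by_contra! hs
  exact absurd hlim (not_le.2 (Real.one_lt_rpow ha hs))

theorem theorem3 (m : ℕ) (hm : 1 ≤ m) (μ ν ε β₁ β₂ a : ℝ)
    (hμ : 0 < μ) (hν : 1 / 2 < ν) (hμν : 1 < μ + ν)
    (hβ₁ : 0 < β₁) (hβ₂ : 0 < β₂) (ha : a = β₂ / β₁) :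
    (fFun μ ν ε β₁ β₂ ∈ Phi m ↔
      CompletelyMonotone (fun x : ℝ =>
        1 / (x ^ μ * (1 + x ^ 2) ^ (((m : ℝ) - 1) / 2 + ν)) -
          a ^ (2 * ν - 1 - ε) /
            (x ^ μ * (1 + a ^ 2 * x ^ 2) ^ (((m : ℝ) - 1) / 2 + ν)))) ∧
    (fFun μ ν ε β₁ β₂ ∈ Phi m → β₁ < β₂ → 2 * ν - 1 ≤ ε) := by
  obtain ⟨k, rfl⟩ : ∃ k, m = k + 1 := ⟨m - 1, by omega⟩
  have ha0 : 0 < a := ha ▸ div_pos hβ₂ hβ₁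
  have hkm : (((k + 1 : ℕ) : ℝ) - 1) / 2 = k / 2 := by push_cast; ring
  rw [hkm]
  obtain ⟨C, hC, hL⟩ := exists_weightedLaplace_radialDifference hμ hν ε k ha0
  obtain ⟨M, hM⟩ := exists_abs_radialDifference_le hμ hν ε k a
  have hσ : -1 < μ + 2 * (ν + k / 2) - 1 := by
    have : (0 : ℝ) ≤ k := k.cast_nonneg
    linarith
  have hiff : fFun μ ν ε β₁ β₂ ∈ Phi (k + 1) ↔
      CompletelyMonotone (fun x : ℝ =>
        1 / (x ^ μ * (1 + x ^ 2) ^ ((k : ℝ) / 2 + ν)) -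
          a ^ (2 * ν - 1 - ε) / (x ^ μ * (1 + a ^ 2 * x ^ 2) ^ ((k : ℝ) / 2 + ν))) := by
    rw [fFun_mem_Phi_iff hμ hν ε k hμν hβ₁ hβ₂, ← ha,
      ← completelyMonotone_weightedLaplace_iff hσ (continuous_radialDifference hμ hν ε k a) hM]
    constructor
    · intro h
      refine (h.const_mul (inv_nonneg.2 hC.le)).congr fun x hx => ?_
      simp only
      rw [hL x hx, inv_mul_cancel_left₀ hC.ne']
    · exact fun h => (h.const_mul hC.le).congr fun x hx => hL x hx
  refine ⟨hiff, fun hf hβ => ?_⟩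
  have h1 : 1 < a := by rwa [ha, one_lt_div hβ₁]
  have h2 := nonpos_of_difference_nonneg h1 fun x hx => by
    simpa using (hiff.1 hf).2 0 x hx
  linarith
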